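/- Fix integers $d\ge 3$, $2\le t\le d$, $R\ge 1$, dimensions $n_1,\dots,n_d$, real numbers $\sigma_1>\dots>\sigma_R>0$ and matrices $U_j=[\mathbf u_{j,1},\dots,\mathbf u_{j,R}]\in\mathbb R^{n_j\times R}$ with unit columns, such that $U_j^\top U_j=I$ for the last $t$ modes $j=d-t+1,\dots,d$. For a noise tensor $\mathcal E\in\mathbb R^{n_1\times\cdots\times n_d}$ put $$\mathcal A=\sum_{i=1}^R\sigma_i\,\mathbf u_{1,i}\otimes\cdots\otimes\mathbf u_{d,i}+\mathcal E .$$ Let $G(W_1,\dots,W_d)=\sum_{i=1}^R\langle\mathcal A,\bigotimes_{j}\mathbf w_{j,i}\rangle^2$, and let $G_{\max}$ be the maximum of $G$ over all $W_j=[\mathbf w_{j,1},\dots,\mathbf w_{j,R}]\in\mathbb R^{n_j\times R}$ with unit columns and $W_j^\top W_j=I$ for $j>d-t$. The following algorithm computes factors $U_1^0,\dots,U_d^0$, $U_j^0=[\mathbf u^0_{j,1},\dots,\mathbf u^0_{j,R}]$, from $\mathcal A$, $R$ and $t$. 1. The columns of $U_d^0$ are left unit singular vectors for the $R$ largest singular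 values, in decreasing order, of the mode-$d$ unfolding $A_{(d)}$. 2. For $j=d-1,\dots,d-t+1$: for each $i$ form $\mathcal B_{j,i}=\mathcal A\times_{j+1}\mathbf u_{j+1,i}^{0\top}\cdots\times_d\mathbf u_{d,i}^{0\top}$ and, if $j>1$, unfold it to $M_{j,i}\in\mathbb R^{n_j\times n_1\cdots n_{j-1}}$ and put $\mathbf v_{j,i}=M_{j,i}\mathbf y_{j,i}$; if $j=1$, put $\mathbf v_{1,i}=\mathcal B_{1,i}$. Here $\mathbf y_{j,i}$ is (A) a leading right unit singular vector of $M_{j,i}$, or (B) the first row of $M_{j,i}$ of largest norm, normalized, or (C) the normalized row of $M_{j,i}$ with an index $\bar k_{j,i}$ drawn at random. Then $U_j^0$ is an orthonormal polar factor of $V_j=[\mathbf v_{j,1},\dots,\mathbf v_{j,R}]$, i.e. $V_j=U_j^0H$ with $(U_j^0)^\top U_j^0=I$ and $H$ symmetric positive semidefinite. 3. If $t<d$, then for each $i$ the unit vectors $\mathbf u^0_{1,i},\dots,\mathbf u^0_{d-t,i}$ are the result of a rank-1 approximation method applied to $\mathcal A\times_{d-t+1}\mathbf u_{d-t+1,i}^{0\top}\cdots\times_d\mathbf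 u_{d,i}^{0\top}$. This method is either (i) steps 1 and 2 themselves, run with $R=1$ and all modes orthonormal, with extraction rule (A), (B) or (C), or (ii) any method that is quasi-optimal: for a fixed constant $\kappa$ and every input $\mathcal T$ it returns unit vectors $\mathbf x_j$ with $\|\mathcal T-\langle\mathcal T,\bigotimes_j\mathbf x_j\rangle\bigotimes_j\mathbf x_j\|_F\le\kappa\,\|\mathcal T-\mathcal S\|_F$ for every tensor $\mathcal S$ of the form $\mu\bigotimes_j\mathbf z_j$. Where rule (C) is used, consider only outcomes of the draws such that the drawn entry $(\mathbf u_{j,i})_{\bar k_{j,i}}$ of the true factor vector is nonzero (every outcome, if these factors have no zero entry). Fix the extraction rule and the rank-1 method. Then there are constants $C\ge 0$ and $\varepsilon>0$, depending only on these choices and on $d,t,R,(n_j),(\sigma_i),(U_j)$, such that for every $\mathcal E$ with $\|\mathcal E\|_F\le\varepsilon$ the maximum $G_{\max}$ is attained, and every such output of the algorithm satisfies $$0\le G_{\max}-G(U_1^0,\dots,U_d^0)\le C\|\mathcal E\|_F$$ and $$\min\{\|\mathbf u^0_{j,i}+\mathbf u_{j,i}\|,\ \|\mathbf u^0_{j,i}-\mathbf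 u_{j,i}\|\}\le C\|\mathcal E\|_F\qquad\text{for all } j=1,\dots,d,\ i=1,\dots,R .$$ -/

import Mathlib

open scoped InnerProductSpace

noncomputable section

/-- Real tensors whose modes are indexed by `ι`, mode `l` having dimension `n l`.  As a Euclidean
space this carries the entrywise inner product and the Frobenius norm. -/
abbrev Tensor {ι : Type} (n : ι → ℕ) : Type :=
  EuclideanSpace ℝ ((l : ι) → Fin (n l))

/-- Factor matrices `(U_l)_l`; `U l i` is the `i`-th column `u_{l,i}` of `U_l ∈ ℝ^{n_l × R}`. -/
abbrev Factors {ι : Type} (n : ι → ℕ) (R : ℕ) : Type :=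
  (l : ι) → Fin R → EuclideanSpace ℝ (Fin (n l))

/-- The rank-1 tensor `⊗_l u_l`. -/
def outer {ι : Type} [Fintype ι] {n : ι → ℕ}
    (u : (l : ι) → EuclideanSpace ℝ (Fin (n l))) : Tensor n :=
  WithLp.toLp 2 fun x => ∏ l, u l (x l)

/-- The objective `G(U) = ∑_i ⟨A, ⊗_l u_{l,i}⟩²`. -/
def objective {ι : Type} [Fintype ι] [LinearOrder ι] {n : ι → ℕ} {R : ℕ}
    (A : Tensor n) (U : Factors n R) : ℝ :=
  ∑ i, ⟪A, outer fun l => U l i⟫_ℝ ^ 2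

/-- The constraints: all columns are unit vectors, and `U_l` is columnwise orthonormal for every
mode `l` in the set `O` of orthonormal modes. -/
def Feasible {ι : Type} {n : ι → ℕ} {R : ℕ} (O : ι → Prop) (U : Factors n R) : Prop :=
  (∀ l i, ‖U l i‖ = 1) ∧ ∀ l, O l → Orthonormal ℝ (U l)

/-- The set of objective values over the feasible set. -/
def objectiveValues {ι : Type} [Fintype ι] [LinearOrder ι] {n : ι → ℕ} (R : ℕ)
    (O : ι → Prop) (A : Tensor n) : Set ℝ :=
  {g | ∃ U : Factors n R, Feasible O U ∧ objective A U = g}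

/-- The optimal value `G_max` of the maximization problem with data tensor `A`. -/
def Gmax {ι : Type} [Fintype ι] [LinearOrder ι] {n : ι → ℕ} (R : ℕ)
    (O : ι → Prop) (A : Tensor n) : ℝ :=
  sSup (objectiveValues R O A)

/-- Matrix-vector product between Euclidean spaces. -/
def mulE {α γ : Type} [Fintype γ] (M : Matrix α γ ℝ) (y : EuclideanSpace ℝ γ) :
    EuclideanSpace ℝ α :=
  WithLp.toLp 2 fun a => ∑ x, M a x * y x

/-- The `k`-th row of a matrix as a Euclidean vector. -/
def rowE {α γ : Type} (M : Matrix α γ ℝ) (k : α) : EuclideanSpace ℝ γ :=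
  WithLp.toLp 2 fun x => M k x

/-- `u_1, …, u_R` are left unit singular vectors of `M` belonging to the `R` largest singular
values `s_1 ≥ … ≥ s_R ≥ 0` (with multiplicity).  The orthogonal complement of the `u_i` is
invariant under `M Mᵀ`, so the last clause says that no remaining singular value exceeds any of
the `s_i`. -/
def IsLeadingLeftSingular {α γ : Type} [Fintype α] [Fintype γ] {R : ℕ}
    (M : Matrix α γ ℝ) (u : Fin R → EuclideanSpace ℝ α) : Prop :=
  Orthonormal ℝ u ∧ ∃ s : Fin R → ℝ, Antitone s ∧ (∀ i, 0 ≤ s i) ∧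
    (∀ i, mulE M (mulE M.transpose (u i)) = (s i ^ 2) • u i) ∧
    ∀ z : EuclideanSpace ℝ α, (∀ i, ⟪u i, z⟫_ℝ = 0) →
      ∀ i, ‖mulE M.transpose z‖ ≤ s i * ‖z‖

/-- `U` is an orthonormal polar factor of `V`: `V = U H`, `Uᵀ U = I`, `H` symmetric positive
semidefinite (`V`, `U` are given by their columns). -/
def IsPolarFactor {α : Type} [Fintype α] {R : ℕ}
    (V U : Fin R → EuclideanSpace ℝ α) : Prop :=
  Orthonormal ℝ U ∧ ∃ H : Matrix (Fin R) (Fin R) ℝ, H.PosSemidef ∧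
    ∀ i, V i = ∑ k, H k i • U k

/-- The three procedures that extract a vector `v = M y` from a matrix `M`. -/
inductive GetVProc : Type
  /-- `y` is the leading right unit singular vector. -/
  | A
  /-- `y` is the normalized row of largest magnitude (the first one among ties). -/
  | B
  /-- `y` is the normalized row with a randomly drawn index. -/
  | C

/-- `v` is a possible result of the given procedure on `M`.  The index `k` is the random draw of
Procedure C; Procedures A and B ignore it. -/
def IsGetV {m : ℕ} {γ : Type} [Fintype γ] (proc : GetVProc) (k : Fin m)
    (M : Matrix (Fin m) γ ℝ) (v : EuclideanSpace ℝ (Fin m)) : Prop :=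
  match proc with
  | GetVProc.A => ∃ y : EuclideanSpace ℝ γ,
      IsLeadingLeftSingular M.transpose (fun _ : Fin 1 => y) ∧ v = mulE M y
  | GetVProc.B => ∃ b : Fin m,
      (∀ c, ‖rowE M c‖ ≤ ‖rowE M b‖) ∧ (∀ c, c < b → ‖rowE M c‖ < ‖rowE M b‖) ∧
      v = mulE M (‖rowE M b‖⁻¹ • rowE M b)
  | GetVProc.C => v = mulE M (‖rowE M k‖⁻¹ • rowE M k)

/-- The matrix `M_j` with rows indexed by mode `j` and columns by the modes below `j`: it is the
unfolding of `B_j = A ×_{j+1} u_{j+1}ᵀ × ⋯ ×_d u_dᵀ`.  Its entry at `(a, x)` is the inner product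
of `A` with the rank-1 tensor having the basis vector `e_{x l}` in the modes `l < j`, the basis
vector `e_a` in mode `j`, and `u_l` in the modes `l > j`.  If `j` is the last mode, it is the
unfolding `A_(j)` of `A`, whatever `u` is. -/
def unfolding {ι : Type} [Fintype ι] [LinearOrder ι] {n : ι → ℕ} (A : Tensor n)
    (u : (l : ι) → EuclideanSpace ℝ (Fin (n l))) (j : ι) :
    Matrix (Fin (n j)) ((l : {l : ι // l < j}) → Fin (n l)) ℝ :=
  fun a x => ⟪A, outer fun l =>
    if h : l < j then EuclideanSpace.single (x ⟨l, h⟩) 1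
    else if h : l = j then EuclideanSpace.single (Fin.cast (congrArg n h.symm) a) 1
    else u l⟫_ℝ

/-- The tensor obtained from `A` by multiplying, in every mode `l` with `O l`, by `u_lᵀ`; it has
the remaining modes.  Its entry at `x` is the inner product of `A` with the rank-1 tensor having
`u_l` in the contracted modes and the basis vectors `e_{x l}` in the others. -/
def contract {ι : Type} [Fintype ι] [LinearOrder ι] {n : ι → ℕ} (O : ι → Prop) [DecidablePred O]
    (A : Tensor n) (u : (l : ι) → EuclideanSpace ℝ (Fin (n l))) :
    Tensor (fun l : {l : ι // ¬ O l} => n l) :=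
  WithLp.toLp 2 fun x => ⟪A, outer fun l =>
    if h : O l then u l else EuclideanSpace.single (x ⟨l, h⟩) 1⟫_ℝ

/-- The first phase of the algorithm, which computes the factors `U_j` of the orthonormal modes
`j` (the upper set `O` of modes) from the last mode downwards, with extraction procedure `proc`
and draws `k`.  The last factor consists of the leading `R` left singular vectors of the last
unfolding.  Every other one is the polar factor of `V_j = [v_{j,1}, …, v_{j,R}]`, where `v_{j,i}`
is extracted from `M_{j,i}`, the unfolding of `A` contracted with the already computed `u_{l,i}`,
`l > j`; if `j` is the first mode, then `M_{j,i}` is a single column and `v_{j,i}` is that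
column. -/
structure OrthonormalPhase {ι : Type} [Fintype ι] [LinearOrder ι] {n : ι → ℕ} {R : ℕ}
    (proc : GetVProc) (O : ι → Prop) (k : (l : ι) → Fin R → Fin (n l))
    (A : Tensor n) (U : Factors n R) : Prop where
  last : ∀ j, IsTop j → ∀ u : (l : ι) → EuclideanSpace ℝ (Fin (n l)),
    IsLeadingLeftSingular (unfolding A u j) (U j)
  step : ∀ j, O j → ¬ IsTop j → ∃ V : Fin R → EuclideanSpace ℝ (Fin (n j)),
    (∀ i, IsBot j → V i = mulE (unfolding A (fun l => U l i) j) (WithLp.toLp 2 fun _ => 1)) ∧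
    (∀ i, ¬ IsBot j → IsGetV proc (k j i) (unfolding A (fun l => U l i) j) (V i)) ∧
    IsPolarFactor V (U j)

/-- The unit vectors `x_l` give a rank-1 approximation `⟨T, ⊗x⟩ ⊗x` of `T` whose error is at most
`κ` times the error of any rank-1 approximation of `T`. -/
def IsQuasiOptimalRank1 {ι : Type} [Fintype ι] [LinearOrder ι] {n : ι → ℕ} (κ : ℝ)
    (T : Tensor n) (x : (l : ι) → EuclideanSpace ℝ (Fin (n l))) : Prop :=
  (∀ l, ‖x l‖ = 1) ∧
    ∀ (μ : ℝ) (z : (l : ι) → EuclideanSpace ℝ (Fin (n l))),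
      ‖T - ⟪T, outer x⟫_ℝ • outer x‖ ≤ κ * ‖T - μ • outer z‖

/-- The rank-1 approximation subroutine: either the algorithm itself, run with `R = 1` and all
modes orthonormal and with one of the three extraction procedures, or any method whose error is
always within a fixed factor `κ` of the best possible one. -/
inductive Rank1Proc : Type
  | self (proc : GetVProc)
  | quasiOptimal (κ : ℝ)

/-- `x` is a possible result of the rank-1 approximation subroutine on `T`; `k` are the draws for
Procedure C. -/
def IsRank1Approx {ι : Type} [Fintype ι] [LinearOrder ι] {n : ι → ℕ} (rk : Rank1Proc)
    (k : (l : ι) → Fin (n l)) (T : Tensor n)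
    (x : (l : ι) → EuclideanSpace ℝ (Fin (n l))) : Prop :=
  match rk with
  | Rank1Proc.self proc =>
      OrthonormalPhase proc (fun _ => True) (fun l (_ : Fin 1) => k l) T (fun l _ => x l)
  | Rank1Proc.quasiOptimal κ => IsQuasiOptimalRank1 κ T x

/-- `U` is a possible output of the approximation algorithm on `A`: the factors of the orthonormal
modes come from the first phase, and for every `i` the remaining columns come from the rank-1
approximation subroutine applied to `A` contracted with the computed orthonormal columns. -/
structure IsAlgorithmOutput {ι : Type} [Fintype ι] [LinearOrder ι] {n : ι → ℕ} {R : ℕ}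
    (proc : GetVProc) (rk : Rank1Proc) (O : ι → Prop) [DecidablePred O]
    (k : (l : ι) → Fin R → Fin (n l)) (A : Tensor n) (U : Factors n R) : Prop where
  orthonormal : OrthonormalPhase proc O k A U
  rank1 : ∀ i, IsRank1Approx rk (fun l : {l : ι // ¬ O l} => k l i)
    (contract O A fun l => U l i) (fun l => U l i)

/-- Wherever Procedure C is in use, the drawn row index hits a nonzero entry of the true factor
vector; equivalently, Procedure C never normalizes a zero row when there is no noise. -/
def GoodDraws {ι : Type} {n : ι → ℕ} {R : ℕ} (proc : GetVProc) (rk : Rank1Proc)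
    (O : ι → Prop) (U : Factors n R) (k : (l : ι) → Fin R → Fin (n l)) : Prop :=
  (proc = GetVProc.C → ∀ j i, O j → U j i (k j i) ≠ 0) ∧
  (rk = Rank1Proc.self GetVProc.C → ∀ j i, ¬ O j → U j i (k j i) ≠ 0)

/-- The last `t` of the `d` modes. -/
abbrev lastModes (d t : ℕ) : Fin d → Prop := fun l => d - t ≤ (l : ℕ)

end

open Asymptotics Filter

/-! Every step of the algorithm is Lipschitz at its noise-free input, where it returns the true
factors up to sign. So quantities are compared modulo O(‖E‖), uniformly over all noises, draws and
outputs, with signs that may differ from one output to the next.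

The last unfolding is, up to noise, ∑ σ_i u_i w_iᵀ. Its u_i are orthonormal, and so are its w_i,
because a second orthonormal mode occurs among their factors. The singular values σ_i are distinct,
so the leading singular vectors are stable (`near_of_isLeadingLeftSingular`). Contracting with
computed columns ±u_{l,i} of at least one orthonormal mode removes all components k ≠ i
(`near_sum_mul_prod_inner`). What remains is a perturbed rank-1 matrix with coefficient ±σ_i, from
which each extraction rule recovers ±σ_i u_{j,i} (`near_of_isGetV`). The polar factor is stable at a
matrix with orthogonal nonzero columns (`near_of_isPolarFactor`), so downward induction over the
modes handles the orthonormal phase. The other modes come from perturbed rank-1 tensors, treated by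
the same argument with R = 1 or by testing quasi-optimality against the true rank-1 tensor.

For the objective, both G_max and the computed value are compared with ∑ σ_i². The computed value is
within O(‖E‖) of it, since squaring removes the signs. Without noise no feasible point exceeds it,
by Cauchy–Schwarz and Bessel's inequality in two orthonormal modes (`objective_sum_smul_outer_le`),
and noise raises the objective by at most O(‖E‖). -/

/-- `f` and `f'` agree up to an error of order `g` along the filter `l`. -/
def Near {X E : Type*} [SeminormedAddCommGroup E] (l : Filter X) (g : X → ℝ) (f f' : X → E) :
    Prop :=
  (fun x => f x - f' x) =O[l] g

/-! ### Calculus of approximation up to O(g) -/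

section Near

variable {X E F : Type*} {l : Filter X} {g : X → ℝ}
variable [SeminormedAddCommGroup E] [SeminormedAddCommGroup F]

theorem Near.refl (f : X → E) : Near l g f f := by
  simpa [Near] using isBigO_zero g l

theorem Near.symm {f f' : X → E} (h : Near l g f f') : Near l g f' f := by
  have := IsBigO.neg_left h
  simpa [Near] using this

theorem Near.trans {f f' f'' : X → E} (h : Near l g f f') (h' : Near l g f' f'') :
    Near l g f f'' := by
  have := IsBigO.add h h'
  simpa [Near] using this

theorem Near.sum {κ : Type*} {s : Finset κ} {f f' : κ → X → E}
    (h : ∀ i ∈ s, Near l g (f i) (f' i)) :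
    Near l g (fun x => ∑ i ∈ s, f i x) (fun x => ∑ i ∈ s, f' i x) := by
  have := IsBigO.sum h
  refine this.congr_left fun x => ?_
  simp

/-- The entry point for quantitative estimates: a pointwise Lipschitz bound with a constant
independent of `x` transfers closeness. -/
theorem Near.norm_le {f f' : X → E} {h h' : X → F} (hf : Near l g f f')
    (H : ∃ C : ℝ, ∀ x, ‖h x - h' x‖ ≤ C * ‖f x - f' x‖) : Near l g h h' := by
  obtain ⟨C, hC⟩ := H
  exact (IsBigO.of_bound C (Eventually.of_forall hC)).trans hf

theorem Near.bounded {f f' : X → E} (hg : g =O[l] fun _ => (1 : ℝ)) (h : Near l g f f')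
    (hf' : f' =O[l] fun _ => (1 : ℝ)) : f =O[l] fun _ => (1 : ℝ) := by
  have := (IsBigO.trans h hg).add hf'
  refine this.congr_left fun x => ?_
  simp

theorem Near.mul {f f' h h' : X → ℝ} (hg : g =O[l] fun _ => (1 : ℝ)) (hf : Near l g f f')
    (hh : Near l g h h') (hf' : f' =O[l] fun _ => (1 : ℝ)) (hh' : h' =O[l] fun _ => (1 : ℝ)) :
    Near l g (fun x => f x * h x) (fun x => f' x * h' x) := by
  have h1 := IsBigO.mul hf (hh.bounded hg hh')
  have h2 := IsBigO.mul hf' hh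
  have := h1.add (h2.congr_right fun x => by simp : _ =O[l] fun x => g x * 1)
  refine (this.congr_left fun x => ?_).congr_right fun x => by simp
  ring

theorem Near.const_mul {f f' : X → ℝ} (h : Near l g f f') (c : ℝ) :
    Near l g (fun x => c * f x) (fun x => c * f' x) := by
  refine (IsBigO.const_mul_left h c).congr_left fun x => ?_
  ring

theorem bounded_one_of_le {f : X → E} (C : ℝ) (h : ∀ x, ‖f x‖ ≤ C) :
    f =O[l] fun _ => (1 : ℝ) :=
  IsBigO.of_bound C (Eventually.of_forall fun x => by simpa using h x)

theorem bounded_one_prod {κ : Type*} {s : Finset κ} {f : κ → X → ℝ}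
    (h : ∀ i ∈ s, f i =O[l] fun _ => (1 : ℝ)) :
    (fun x => ∏ i ∈ s, f i x) =O[l] fun _ => (1 : ℝ) := by
  have := IsBigO.finsetProd h
  simpa using this

theorem Near.prod {κ : Type*} {s : Finset κ} {f f' : κ → X → ℝ}
    (hg : g =O[l] fun _ => (1 : ℝ)) (h : ∀ i ∈ s, Near l g (f i) (f' i))
    (h' : ∀ i ∈ s, f' i =O[l] fun _ => (1 : ℝ)) :
    Near l g (fun x => ∏ i ∈ s, f i x) (fun x => ∏ i ∈ s, f' i x) := by
  classical
  induction s using Finset.induction_on with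
  | empty => simpa using Near.refl _
  | insert a s ha ih =>
    simp only [Finset.prod_insert ha]
    exact Near.mul hg (h a (by simp)) (ih (fun i hi => h i (by simp [hi]))
      fun i hi => h' i (by simp [hi])) (h' a (by simp))
      (bounded_one_prod fun i hi => h' i (by simp [hi]))

end Near

/-! ### Matrix-vector products and coordinatewise estimates -/

section MulE

variable {α γ : Type} [Fintype γ]

theorem mulE_add (M : Matrix α γ ℝ) (y z : EuclideanSpace ℝ γ) :
    mulE M (y + z) = mulE M y + mulE M z := by
  ext a
  simp [mulE, mul_add, Finset.sum_add_distrib]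

theorem mulE_smul (M : Matrix α γ ℝ) (c : ℝ) (y : EuclideanSpace ℝ γ) :
    mulE M (c • y) = c • mulE M y := by
  ext a
  simp [mulE, Finset.mul_sum, mul_left_comm]

theorem mulE_sum {κ : Type*} (s : Finset κ) (M : Matrix α γ ℝ) (y : κ → EuclideanSpace ℝ γ) :
    mulE M (∑ i ∈ s, y i) = ∑ i ∈ s, mulE M (y i) := by
  ext a
  simp [mulE, Finset.mul_sum]
  exact Finset.sum_comm

theorem mulE_sub_left (M N : Matrix α γ ℝ) (y : EuclideanSpace ℝ γ) :
    mulE (M - N) y = mulE M y - mulE N y := by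
  ext a
  simp [mulE, sub_mul]

end MulE

section Euclidean

variable {X : Type*} {α γ : Type} [Fintype α] [Fintype γ] {l : Filter X} {g : X → ℝ}

theorem EuclideanSpace.norm_le_sum_abs (v : EuclideanSpace ℝ α) : ‖v‖ ≤ ∑ a, |v a| := by
  rw [EuclideanSpace.norm_eq]
  refine Real.sqrt_le_iff.2 ⟨Finset.sum_nonneg fun a _ => abs_nonneg _, ?_⟩
  simpa using Finset.sum_sq_le_sq_sum_of_nonneg (s := Finset.univ) (f := fun a => |v a|)
    fun a _ => abs_nonneg _

theorem near_iff_apply {f f' : X → EuclideanSpace ℝ α} :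
    Near l g f f' ↔ ∀ a, Near l g (fun x => f x a) (fun x => f' x a) := by
  constructor
  · intro h a
    refine h.norm_le ⟨1, fun x => ?_⟩
    simpa using PiLp.norm_apply_le (f x - f' x) a
  · intro h
    have := IsBigO.sum (s := Finset.univ) fun a _ => (h a).norm_left
    refine (IsBigO.of_bound 1 (Eventually.of_forall fun x => ?_)).trans this
    have := EuclideanSpace.norm_le_sum_abs (f x - f' x)
    rw [one_mul, Finset.sum_apply,
      Real.norm_of_nonneg (Finset.sum_nonneg fun a _ => norm_nonneg _)]
    simpa using this

theorem bounded_one_apply {f : X → EuclideanSpace ℝ α} (h : f =O[l] fun _ => (1 : ℝ)) (a : α) :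
    (fun x => f x a) =O[l] fun _ => (1 : ℝ) := by
  refine (IsBigO.of_bound 1 (Eventually.of_forall fun x => ?_)).trans h
  simpa using PiLp.norm_apply_le (f x) a

theorem EuclideanSpace.real_inner_eq_sum (u v : EuclideanSpace ℝ α) :
    ⟪u, v⟫_ℝ = ∑ a, u a * v a := by
  simp [PiLp.inner_apply, mul_comm]

theorem Near.inner {f f' h h' : X → EuclideanSpace ℝ α} (hg : g =O[l] fun _ => (1 : ℝ))
    (hf : Near l g f f') (hh : Near l g h h') (hf' : f' =O[l] fun _ => (1 : ℝ))
    (hh' : h' =O[l] fun _ => (1 : ℝ)) :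
    Near l g (fun x => ⟪f x, h x⟫_ℝ) (fun x => ⟪f' x, h' x⟫_ℝ) := by
  simp only [EuclideanSpace.real_inner_eq_sum]
  exact Near.sum fun a _ => Near.mul hg (near_iff_apply.1 hf a) (near_iff_apply.1 hh a)
    (bounded_one_apply hf' a) (bounded_one_apply hh' a)

theorem Near.smul {f f' : X → ℝ} {h h' : X → EuclideanSpace ℝ α}
    (hg : g =O[l] fun _ => (1 : ℝ))
    (hf : Near l g f f') (hh : Near l g h h') (hf' : f' =O[l] fun _ => (1 : ℝ))
    (hh' : h' =O[l] fun _ => (1 : ℝ)) :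
    Near l g (fun x => f x • h x) (fun x => f' x • h' x) := by
  rw [near_iff_apply]
  intro a
  simpa using Near.mul hg hf (near_iff_apply.1 hh a) hf' (bounded_one_apply hh' a)

theorem Near.mulE {M M' : X → Matrix α γ ℝ} {y y' : X → EuclideanSpace ℝ γ}
    (hg : g =O[l] fun _ => (1 : ℝ))
    (hM : ∀ a b, Near l g (fun x => M x a b) (fun x => M' x a b)) (hy : Near l g y y')
    (hM' : ∀ a b, (fun x => M' x a b) =O[l] fun _ => (1 : ℝ)) (hy' : y' =O[l] fun _ => (1 : ℝ)) :
    Near l g (fun x => mulE (M x) (y x)) (fun x => mulE (M' x) (y' x)) := by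
  rw [near_iff_apply]
  intro a
  simp only [_root_.mulE]
  exact Near.sum fun b _ => Near.mul hg (hM a b) (near_iff_apply.1 hy b) (hM' a b)
    (bounded_one_apply hy' b)

theorem inner_mulE_left (M : Matrix α γ ℝ) (y : EuclideanSpace ℝ γ) (z : EuclideanSpace ℝ α) :
    ⟪mulE M y, z⟫_ℝ = ⟪y, mulE M.transpose z⟫_ℝ := by
  simp only [EuclideanSpace.real_inner_eq_sum, mulE, Finset.sum_mul, Finset.mul_sum,
    Matrix.transpose_apply]
  rw [Finset.sum_comm]
  exact Finset.sum_congr rfl fun _ _ => Finset.sum_congr rfl fun _ _ => by ring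

theorem norm_mulE_le (M : Matrix α γ ℝ) (y : EuclideanSpace ℝ γ) :
    ‖mulE M y‖ ≤ (∑ a, ∑ b, |M a b|) * ‖y‖ := by
  refine (EuclideanSpace.norm_le_sum_abs _).trans ?_
  simp only [mulE, Finset.sum_mul]
  refine Finset.sum_le_sum fun a _ => (Finset.abs_sum_le_sum_abs _ _).trans
    (Finset.sum_le_sum fun b _ => ?_)
  rw [abs_mul]
  gcongr
  exact PiLp.norm_apply_le y b

end Euclidean

/-! ### Signs and unit vectors -/

/-- A sign is a real number equal to `1` or `-1`. -/
def IsSign (s : ℝ) : Prop := s = 1 ∨ s = -1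

theorem IsSign.abs {s : ℝ} (h : IsSign s) : |s| = 1 := by
  rcases h with rfl | rfl <;> simp

theorem IsSign.mul_self {s : ℝ} (h : IsSign s) : s * s = 1 := by
  rcases h with rfl | rfl <;> simp

theorem IsSign.mul {s t : ℝ} (hs : IsSign s) (ht : IsSign t) : IsSign (s * t) := by
  rcases hs with rfl | rfl <;> rcases ht with rfl | rfl <;> simp [IsSign]

theorem IsSign.prod {κ : Type*} {t : Finset κ} {s : κ → ℝ} (h : ∀ i ∈ t, IsSign (s i)) :
    IsSign (∏ i ∈ t, s i) :=
  Finset.prod_induction _ IsSign (fun _ _ => IsSign.mul) (Or.inl rfl) h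

theorem exists_isSign_mul_abs (c : ℝ) : ∃ s, IsSign s ∧ c = s * |c| := by
  rcases le_total 0 c with h | h
  · exact ⟨1, Or.inl rfl, by simp [abs_of_nonneg h]⟩
  · exact ⟨-1, Or.inr rfl, by simp [abs_of_nonpos h]⟩

section Unit

variable {E : Type*} [NormedAddCommGroup E] [InnerProductSpace ℝ E]

/-- By the reverse triangle inequality |c| differs from 1 by at most the error, so replacing `c` by
its sign at most doubles the error. -/
theorem exists_isSign_norm_sub_le {y u : E} (hy : ‖y‖ = 1) (hu : ‖u‖ = 1) (c : ℝ) :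
    ∃ s, IsSign s ∧ ‖y - s • u‖ ≤ 2 * ‖y - c • u‖ := by
  obtain ⟨s, hs, hc⟩ := exists_isSign_mul_abs c
  refine ⟨s, hs, ?_⟩
  have h1 : ‖c • u - s • u‖ = |(|c| - 1)| := by
    rw [← sub_smul, norm_smul, hu, mul_one, Real.norm_eq_abs]
    conv_lhs => rw [hc, show s * |c| - s = s * (|c| - 1) by ring, abs_mul, hs.abs, one_mul]
  have h2 : |(|c| - 1)| ≤ ‖y - c • u‖ := by
    have := abs_norm_sub_norm_le (c • u) y
    rwa [norm_smul, hu, hy, mul_one, Real.norm_eq_abs, norm_sub_rev] at this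
  have h3 := norm_sub_le_norm_sub_add_norm_sub y (c • u) (s • u)
  linarith

/-- Keeping the factor |c| on the left avoids any lower bound on |c| or on `r`; the case `r = 0` is
covered by the convention that its normalization is zero. -/
theorem exists_isSign_norm_normalize_sub_le (r w : E) (hw : ‖w‖ = 1) (c : ℝ) :
    ∃ s, IsSign s ∧ |c| * ‖‖r‖⁻¹ • r - s • w‖ ≤ 2 * ‖r - c • w‖ := by
  obtain ⟨s, hs, hc⟩ := exists_isSign_mul_abs c
  refine ⟨s, hs, ?_⟩
  have h0 : |c| * ‖‖r‖⁻¹ • r - s • w‖ = ‖|c| • (‖r‖⁻¹ • r) - c • w‖ := by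
    have : c • w = |c| • s • w := by rw [smul_smul, mul_comm, ← hc]
    rw [this, ← smul_sub, norm_smul, Real.norm_eq_abs, abs_abs]
  have h2 : |(|c| - ‖r‖)| ≤ ‖r - c • w‖ := by
    have := abs_norm_sub_norm_le (c • w) r
    rwa [norm_smul, hw, mul_one, Real.norm_eq_abs, norm_sub_rev] at this
  have h1 : ‖|c| • (‖r‖⁻¹ • r) - r‖ ≤ |(|c| - ‖r‖)| := by
    rcases eq_or_ne r 0 with rfl | hr
    · simp
    · have : |c| • (‖r‖⁻¹ • r) - r = (|c| - ‖r‖) • (‖r‖⁻¹ • r) := by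
        rw [sub_smul, smul_smul ‖r‖, mul_inv_cancel₀ (norm_ne_zero_iff.2 hr), one_smul]
      rw [this, norm_smul, norm_smul, norm_inv, norm_norm,
        inv_mul_cancel₀ (norm_ne_zero_iff.2 hr), mul_one, Real.norm_eq_abs]
  have h3 := norm_sub_le_norm_sub_add_norm_sub (|c| • (‖r‖⁻¹ • r)) r (c • w)
  rw [h0]
  linarith

theorem Orthonormal.isSign_smul {κ : Type*} {u : κ → E} (hu : Orthonormal ℝ u) {s : κ → ℝ}
    (hs : ∀ i, IsSign (s i)) : Orthonormal ℝ fun i => s i • u i := by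
  refine ⟨fun i => ?_, fun i k hik => ?_⟩
  · rw [norm_smul, Real.norm_eq_abs, (hs i).abs, hu.1 i, one_mul]
  · simp [inner_smul_left, inner_smul_right, hu.2 hik]

end Unit

/-! ### Matrices given by a singular-value-type expansion -/

section SumOuterMatrix

variable {α γ : Type} {R : ℕ}

/-- The matrix `∑ σ_i u_i w_iᵀ`. -/
def sumOuterMatrix (σ : Fin R → ℝ) (u : Fin R → EuclideanSpace ℝ α)
    (w : Fin R → EuclideanSpace ℝ γ) : Matrix α γ ℝ :=
  fun a b => ∑ i, σ i * (u i a * w i b)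

theorem mulE_sumOuterMatrix [Fintype γ] (σ : Fin R → ℝ) (u : Fin R → EuclideanSpace ℝ α)
    (w : Fin R → EuclideanSpace ℝ γ) (y : EuclideanSpace ℝ γ) :
    mulE (sumOuterMatrix σ u w) y = ∑ i, (σ i * ⟪w i, y⟫_ℝ) • u i := by
  ext a
  simp only [mulE, sumOuterMatrix, EuclideanSpace.real_inner_eq_sum, Finset.sum_mul,
    Finset.mul_sum, WithLp.ofLp_sum, Finset.sum_apply, PiLp.smul_apply, smul_eq_mul]
  rw [Finset.sum_comm]
  exact Finset.sum_congr rfl fun _ _ => Finset.sum_congr rfl fun _ _ => by ring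

theorem transpose_sumOuterMatrix (σ : Fin R → ℝ) (u : Fin R → EuclideanSpace ℝ α)
    (w : Fin R → EuclideanSpace ℝ γ) :
    (sumOuterMatrix σ u w).transpose = sumOuterMatrix σ w u := by
  ext a b
  simp [sumOuterMatrix, mul_comm]

theorem bounded_one_sumOuterMatrix {X : Type*} {l : Filter X} {σ : X → Fin R → ℝ} {τ : Fin R → ℝ}
    (hσ : ∀ x i, |σ x i| = τ i) (u : Fin R → EuclideanSpace ℝ α)
    (w : Fin R → EuclideanSpace ℝ γ) (a : α) (b : γ) :
    (fun x => sumOuterMatrix (σ x) u w a b) =O[l] fun _ => (1 : ℝ) := by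
  refine bounded_one_of_le (∑ i, τ i * |u i a * w i b|) fun x => ?_
  refine (Finset.abs_sum_le_sum_abs _ _).trans (Finset.sum_le_sum fun i _ => ?_)
  rw [abs_mul, hσ]

end SumOuterMatrix

/-! ### Variational bounds and Weyl's inequality for singular values -/

section LeadingSingular

variable {α γ : Type} [Fintype α] [Fintype γ] {R : ℕ}

/-- `IsLeadingLeftSingular` with the singular values made explicit. -/
structure HasLeadingLeftSingular (M : Matrix α γ ℝ) (u : Fin R → EuclideanSpace ℝ α)
    (s : Fin R → ℝ) : Prop where
  orthonormal : Orthonormal ℝ u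
  antitone : Antitone s
  nonneg : ∀ i, 0 ≤ s i
  eigen : ∀ i, mulE M (mulE M.transpose (u i)) = (s i ^ 2) • u i
  norm_le : ∀ z : EuclideanSpace ℝ α, (∀ i, ⟪u i, z⟫_ℝ = 0) →
    ∀ i, ‖mulE M.transpose z‖ ≤ s i * ‖z‖

theorem IsLeadingLeftSingular.exists_values {M : Matrix α γ ℝ}
    {u : Fin R → EuclideanSpace ℝ α} (h : IsLeadingLeftSingular M u) :
    ∃ s, HasLeadingLeftSingular M u s := by
  obtain ⟨ho, s, h1, h2, h3, h4⟩ := h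
  exact ⟨s, ho, h1, h2, h3, h4⟩

theorem inner_mulE_transpose (M : Matrix α γ ℝ) (y z : EuclideanSpace ℝ α) :
    ⟪mulE M.transpose y, mulE M.transpose z⟫_ℝ = ⟪mulE M (mulE M.transpose y), z⟫_ℝ :=
  (inner_mulE_left M _ z).symm

namespace HasLeadingLeftSingular

variable {M N : Matrix α γ ℝ} {u v : Fin R → EuclideanSpace ℝ α} {s τ : Fin R → ℝ}

theorem mulE_sum_smul (h : HasLeadingLeftSingular M u s) (a : Fin R → ℝ) :
    mulE M (mulE M.transpose (∑ k, a k • u k)) = ∑ k, (a k * s k ^ 2) • u k := by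
  simp only [mulE_sum, mulE_smul, h.eigen, smul_smul]

theorem norm_mulE_sum_sq (h : HasLeadingLeftSingular M u s) (a : Fin R → ℝ) :
    ‖mulE M.transpose (∑ k, a k • u k)‖ ^ 2 = ∑ k, a k ^ 2 * s k ^ 2 := by
  rw [← real_inner_self_eq_norm_sq, inner_mulE_transpose, h.mulE_sum_smul, h.orthonormal.inner_sum]
  exact Finset.sum_congr rfl fun k _ => by simp; ring

theorem norm_sum_sq (h : HasLeadingLeftSingular M u s) (a : Fin R → ℝ) :
    ‖∑ k, a k • u k‖ ^ 2 = ∑ k, a k ^ 2 := by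
  rw [← real_inner_self_eq_norm_sq, h.orthonormal.inner_sum]
  exact Finset.sum_congr rfl fun k _ => by simp; ring

/-- One half of the min-max principle: on the span of the first singular vectors, up to index `i`,
the matrix stretches by at least `s i`. -/
theorem le_norm_mulE (h : HasLeadingLeftSingular M u s) (i : Fin R) (a : Fin R → ℝ)
    (ha : ∀ k, i < k → a k = 0) :
    s i * ‖∑ k, a k • u k‖ ≤ ‖mulE M.transpose (∑ k, a k • u k)‖ := by
  refine le_of_sq_le_sq ?_ (norm_nonneg _)
  rw [mul_pow, h.norm_sum_sq, h.norm_mulE_sum_sq, Finset.mul_sum]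
  refine Finset.sum_le_sum fun k _ => ?_
  rcases lt_or_ge i k with hk | hk
  · simp [ha k hk]
  · rw [mul_comm]
    have := pow_le_pow_left₀ (h.nonneg i) (h.antitone hk) 2
    gcongr

/-- The other half of the min-max principle. The vector is split along the span of the `u k`; since
M Mᵀ preserves this span, the images of the two parts stay orthogonal and can be bounded separately.
-/
theorem norm_mulE_le (h : HasLeadingLeftSingular M u s) (i : Fin R) (z : EuclideanSpace ℝ α)
    (hz : ∀ k, k < i → ⟪u k, z⟫_ℝ = 0) : ‖mulE M.transpose z‖ ≤ s i * ‖z‖ := by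
  set p := ∑ k, ⟪u k, z⟫_ℝ • u k with hp
  have hr : ∀ k, ⟪u k, z - p⟫_ℝ = 0 := fun k => by
    rw [inner_sub_right, hp, h.orthonormal.inner_right_fintype, sub_self]
  have hpr : ∀ a : Fin R → ℝ, ⟪∑ k, a k • u k, z - p⟫_ℝ = 0 := fun a => by
    simp [sum_inner, inner_smul_left, hr]
  have hzp : z = p + (z - p) := by abel
  refine le_of_sq_le_sq ?_ (mul_nonneg (h.nonneg i) (norm_nonneg _))
  have h1 : ‖z‖ ^ 2 = ‖p‖ ^ 2 + ‖z - p‖ ^ 2 := by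
    conv_lhs => rw [hzp]
    rw [norm_add_sq_real, hpr]
    ring
  have h2 : ‖mulE M.transpose z‖ ^ 2 =
      ‖mulE M.transpose p‖ ^ 2 + ‖mulE M.transpose (z - p)‖ ^ 2 := by
    conv_lhs => rw [hzp, mulE_add]
    rw [norm_add_sq_real, inner_mulE_transpose, h.mulE_sum_smul, hpr]
    ring
  have h3 : ‖mulE M.transpose p‖ ^ 2 ≤ s i ^ 2 * ‖p‖ ^ 2 := by
    rw [h.norm_sum_sq, h.norm_mulE_sum_sq, Finset.mul_sum]
    refine Finset.sum_le_sum fun k _ => ?_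
    rcases lt_or_ge k i with hk | hk
    · simp [hz k hk]
    · rw [mul_comm]
      have := pow_le_pow_left₀ (h.nonneg k) (h.antitone hk) 2
      gcongr
  have h4 := pow_le_pow_left₀ (norm_nonneg _) (h.norm_le (z - p) hr i) 2
  rw [mul_pow] at h4 ⊢
  rw [h1, h2]
  linarith

/-- A dimension count. The linear map collects one condition for each index other than `i`:
orthogonality to `v k` below `i`, vanishing of the coefficient above. With R unknowns and R − 1
conditions its kernel is nontrivial. -/
theorem exists_orthogonal_ne_zero (i : Fin R) (v : Fin R → EuclideanSpace ℝ α)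
    (u : Fin R → EuclideanSpace ℝ α) : ∃ a : Fin R → ℝ, a ≠ 0 ∧ (∀ k, i < k → a k = 0) ∧
      ∀ k, k < i → ⟪v k, ∑ m, a m • u m⟫_ℝ = 0 := by
  let f : (Fin R → ℝ) →ₗ[ℝ] ({k : Fin R // k ≠ i} → ℝ) :=
    { toFun := fun a k => if (k : Fin R) < i then ⟪v k, ∑ m, a m • u m⟫_ℝ else a k
      map_add' := fun a b => by
        ext k
        simp only [Pi.add_apply, add_smul, Finset.sum_add_distrib, inner_add_right]
        split_ifs <;> rfl
      map_smul' := fun c a => by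
        ext k
        simp only [Pi.smul_apply, smul_eq_mul, mul_smul, ← Finset.smul_sum, inner_smul_right,
          RingHom.id_apply]
        split_ifs <;> rfl }
  have hf : LinearMap.ker f ≠ ⊥ := by
    refine LinearMap.ker_ne_bot_of_finrank_lt ?_
    simp only [Module.finrank_fintype_fun_eq_card]
    exact Fintype.card_subtype_lt (x := i) (by simp)
  obtain ⟨a, ha, ha0⟩ := (Submodule.ne_bot_iff _).1 hf
  have hk : ∀ k : Fin R, (hk : k ≠ i) →
      (if k < i then ⟪v k, ∑ m, a m • u m⟫_ℝ else a k) = 0 := fun k hk =>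
    congrFun (LinearMap.mem_ker.1 ha) ⟨k, hk⟩
  refine ⟨a, ha0, fun k h => ?_, fun k h => ?_⟩
  · simpa [h.not_gt] using hk k h.ne'
  · simpa [h] using hk k h.ne

/-- Weyl's inequality. A common test vector lies in the span of the first singular vectors of `M`
and is orthogonal to the earlier ones of `N`; both halves of the min-max principle apply to it. The
entrywise sum dominates the operator norm of the difference. -/
theorem value_le (h : HasLeadingLeftSingular M u s) (h' : HasLeadingLeftSingular N v τ)
    (i : Fin R) : s i ≤ τ i + ∑ b, ∑ a, |M a b - N a b| := by
  obtain ⟨a, ha, ha1, ha2⟩ := exists_orthogonal_ne_zero i v u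
  set z := ∑ m, a m • u m with hz
  have hz0 : 0 < ‖z‖ := by
    rw [norm_pos_iff]
    intro h0
    refine ha (funext fun k => ?_)
    have := h.orthonormal.inner_right_fintype a k
    rw [← hz, h0, inner_zero_right] at this
    simpa using this.symm
  have h1 := h.le_norm_mulE i a ha1
  rw [← hz] at h1
  have h2 := h'.norm_mulE_le i z ha2
  have h3 := _root_.norm_mulE_le (M - N).transpose z
  rw [Matrix.transpose_sub, mulE_sub_left] at h3
  have h4 := norm_sub_norm_le (mulE M.transpose z) (mulE N.transpose z)
  refine le_of_mul_le_mul_right ?_ hz0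
  rw [add_mul]
  simp only [Matrix.sub_apply, Matrix.transpose_apply] at h3
  linarith

theorem abs_value_sub_le (h : HasLeadingLeftSingular M u s)
    (h' : HasLeadingLeftSingular N v τ) (i : Fin R) :
    |s i - τ i| ≤ ∑ b, ∑ a, |M a b - N a b| := by
  have h1 := h.value_le h' i
  have h2 := h'.value_le h i
  simp only [abs_sub_comm (N _ _)] at h2
  rw [abs_le]
  constructor <;> linarith

end HasLeadingLeftSingular

theorem mulE_mulE_sumOuterMatrix (σ : Fin R → ℝ) (u : Fin R → EuclideanSpace ℝ α)
    {w : Fin R → EuclideanSpace ℝ γ} (hw : Orthonormal ℝ w) (y : EuclideanSpace ℝ α) :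
    mulE (sumOuterMatrix σ u w) (mulE (sumOuterMatrix σ u w).transpose y) =
      ∑ i, (σ i ^ 2 * ⟪u i, y⟫_ℝ) • u i := by
  rw [transpose_sumOuterMatrix, mulE_sumOuterMatrix, mulE_sumOuterMatrix]
  refine Finset.sum_congr rfl fun i _ => ?_
  rw [hw.inner_right_fintype]
  ring_nf

/-- The coefficients may be negative because contractions with computed vectors introduce
uncontrolled signs; only their absolute values matter. -/
theorem hasLeadingLeftSingular_sumOuterMatrix {σ τ : Fin R → ℝ} (hσ : ∀ i, |σ i| = τ i)
    (hτ : Antitone τ) {u : Fin R → EuclideanSpace ℝ α} {w : Fin R → EuclideanSpace ℝ γ}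
    (hu : Orthonormal ℝ u) (hw : Orthonormal ℝ w) :
    HasLeadingLeftSingular (sumOuterMatrix σ u w) u τ where
  orthonormal := hu
  antitone := hτ
  nonneg i := hσ i ▸ abs_nonneg _
  eigen i := by
    rw [mulE_mulE_sumOuterMatrix σ u hw, Finset.sum_eq_single i]
    · rw [real_inner_self_eq_norm_sq, hu.1, ← hσ, sq_abs]
      norm_num
    · intro k _ hk
      simp [hu.2 hk]
    · simp
  norm_le z hz i := by
    rw [transpose_sumOuterMatrix, mulE_sumOuterMatrix]
    simp only [hz, mul_zero, zero_smul, Finset.sum_const_zero, norm_zero]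
    exact mul_nonneg (hσ i ▸ abs_nonneg _) (norm_nonneg _)

end LeadingSingular

/-! ### Stability of singular vectors and of the polar factor -/

section Perturbation

variable {X : Type*} {α γ : Type} [Fintype α] [Fintype γ] {R : ℕ} {l : Filter X} {g : X → ℝ}

/-- Leading singular vectors belonging to simple singular values depend Lipschitz continuously,
up to sign, on the matrix. -/
theorem near_of_isLeadingLeftSingular (hg : g =O[l] fun _ => (1 : ℝ)) {σ : X → Fin R → ℝ}
    {τ : Fin R → ℝ} (hσ : ∀ x i, |σ x i| = τ i) (hτ : StrictAnti τ) (hτ0 : ∀ i, 0 < τ i)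
    {u : Fin R → EuclideanSpace ℝ α} {w : Fin R → EuclideanSpace ℝ γ}
    (hu : Orthonormal ℝ u) (hw : Orthonormal ℝ w) {M : X → Matrix α γ ℝ}
    (hM : ∀ a b, Near l g (fun x => M x a b) (fun x => sumOuterMatrix (σ x) u w a b))
    {y : X → Fin R → EuclideanSpace ℝ α} (hy : ∀ x, IsLeadingLeftSingular (M x) (y x)) :
    ∃ s : X → Fin R → ℝ, (∀ x i, IsSign (s x i)) ∧
      ∀ i, Near l g (fun x => y x i) (fun x => s x i • u i) := by
  choose t ht using fun x => (hy x).exists_values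
  have hM0 := bounded_one_sumOuterMatrix (l := l) hσ u w
  have h0 := fun x => hasLeadingLeftSingular_sumOuterMatrix (hσ x) hτ.antitone hu hw
  have hy1 : ∀ i, (fun x => y x i) =O[l] fun _ => (1 : ℝ) := fun i =>
    bounded_one_of_le 1 fun x => ((ht x).orthonormal.1 i).le
  -- Weyl's inequality against the noise-free matrix.
  have ht1 : ∀ i, Near l g (fun x => t x i) (fun _ => τ i) := fun i => by
    have : Near l g (fun x => ∑ b, ∑ a, |M x a b - sumOuterMatrix (σ x) u w a b|)
        (fun _ => ∑ _b : γ, ∑ _a : α, 0) := Near.sum fun b _ => Near.sum fun a _ => by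
      simpa [Near] using (hM a b).norm_left
    refine this.norm_le ⟨1, fun x => ?_⟩
    have := (ht x).abs_value_sub_le (h0 x) i
    simp only [Finset.sum_const_zero, sub_zero, one_mul, Real.norm_eq_abs]
    exact this.trans (le_abs_self _)
  have ht2 : ∀ i, Near l g (fun x => t x i ^ 2) (fun _ => τ i ^ 2) := fun i => by
    simpa only [sq] using Near.mul hg (ht1 i) (ht1 i) (bounded_one_of_le _ fun _ => le_rfl)
      (bounded_one_of_le _ fun _ => le_rfl)
  -- In the eigenvector equation for M Mᵀ, both the eigenvalue and the matrix are replaced by their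
  -- noise-free counterparts.
  have key : ∀ i, Near l g (fun x => (τ i ^ 2) • y x i)
      (fun x => ∑ k, (τ k ^ 2 * ⟪u k, y x i⟫_ℝ) • u k) := fun i => by
    have e1 : Near l g (fun x => (t x i ^ 2) • y x i) (fun x => (τ i ^ 2) • y x i) :=
      Near.smul hg (ht2 i) (Near.refl _) (bounded_one_of_le _ fun _ => le_rfl) (hy1 i)
    have e2 : Near l g (fun x => mulE (M x).transpose (y x i))
        (fun x => mulE (sumOuterMatrix (σ x) u w).transpose (y x i)) :=
      Near.mulE hg (fun b a => hM a b) (Near.refl _) (fun b a => hM0 a b) (hy1 i)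
    have e3 : (fun x => mulE (sumOuterMatrix (σ x) u w).transpose (y x i)) =O[l]
        fun _ => (1 : ℝ) := by
      refine bounded_one_of_le (∑ b, ∑ a, ∑ k, τ k * |u k a * w k b|) fun x => ?_
      refine (_root_.norm_mulE_le _ _).trans ?_
      rw [(ht x).orthonormal.1, mul_one]
      refine Finset.sum_le_sum fun b _ => Finset.sum_le_sum fun a _ => ?_
      change |∑ k, σ x k * (u k a * w k b)| ≤ _
      refine (Finset.abs_sum_le_sum_abs _ _).trans (Finset.sum_le_sum fun k _ => ?_)
      rw [abs_mul, hσ]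
    have e4 := Near.mulE hg hM e2 hM0 e3
    refine e1.symm.trans ?_
    simp only [(ht _).eigen, mulE_mulE_sumOuterMatrix _ u hw] at e4
    simpa only [← sq_abs (σ _ _), hσ] using e4
  -- Pairing `key` with `u k` gives (τ_i² − τ_k²)⟨u_k, y_i⟩ = O(g); the gap is nonzero because the τ
  -- are distinct and positive.
  have hin : ∀ i k, k ≠ i → Near l g (fun x => ⟪u k, y x i⟫_ℝ) (fun _ => 0) := fun i k hk => by
    refine (key i).norm_le ⟨|τ i ^ 2 - τ k ^ 2|⁻¹, fun x => ?_⟩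
    have hne : 0 < |τ i ^ 2 - τ k ^ 2| := by
      rw [abs_pos, sub_ne_zero]
      intro h
      exact hk (hτ.injective ((pow_left_inj₀ (hτ0 i).le (hτ0 k).le two_ne_zero).1 h)).symm
    have h1 := abs_real_inner_le_norm (u k)
      ((τ i ^ 2) • y x i - ∑ k, (τ k ^ 2 * ⟪u k, y x i⟫_ℝ) • u k)
    rw [inner_sub_right, hu.inner_right_fintype, inner_smul_right, ← sub_mul, abs_mul, hu.1,
      one_mul] at h1
    rw [sub_zero, Real.norm_eq_abs, ← div_eq_inv_mul, le_div_iff₀ hne]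
    linarith
  -- Only the component along `u i` survives in `key`; division by τ_i² > 0 puts `y i` close to the
  -- line through `u i`.
  have hfin : ∀ i, Near l g (fun x => y x i) (fun x => ⟪u i, y x i⟫_ℝ • u i) := fun i => by
    have e1 : Near l g (fun x => ∑ k, (τ k ^ 2 * ⟪u k, y x i⟫_ℝ) • u k)
        (fun x => ∑ k, if k = i then (τ i ^ 2 * ⟪u i, y x i⟫_ℝ) • u i else 0) := by
      refine Near.sum fun k _ => ?_
      split_ifs with hk
      · subst hk
        exact Near.refl _
      · refine (hin i k hk).norm_le ⟨τ k ^ 2 * ‖u k‖, fun x => ?_⟩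
        rw [sub_zero, sub_zero, norm_smul, norm_mul, Real.norm_of_nonneg (sq_nonneg (τ k))]
        exact le_of_eq (by ring)
    simp only [Finset.sum_ite_eq', Finset.mem_univ, if_true] at e1
    refine ((key i).trans e1).norm_le ⟨(τ i ^ 2)⁻¹, fun x => ?_⟩
    have h2 : 0 < τ i ^ 2 := by have := hτ0 i; positivity
    rw [mul_smul, ← smul_sub, norm_smul, Real.norm_of_nonneg h2.le,
      inv_mul_cancel_left₀ h2.ne']
  choose s hs hs' using fun x i => exists_isSign_norm_sub_le ((ht x).orthonormal.1 i) (hu.1 i)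
    ⟪u i, y x i⟫_ℝ
  exact ⟨s, hs, fun i => (hfin i).norm_le ⟨2, fun x => hs' x i⟩⟩

/-- Stability of the polar factor at matrices with orthogonal nonzero columns. -/
theorem sum_norm_sub_polarFactor_sq_le {V P P₀ : Fin R → EuclideanSpace ℝ α} {τ : Fin R → ℝ}
    (hP : IsPolarFactor V P) (hP₀ : Orthonormal ℝ P₀) :
    ∑ i, τ i * ‖P i - P₀ i‖ ^ 2 ≤ 2 * ∑ i, ⟪P i - P₀ i, V i - τ i • P₀ i⟫_ℝ := by
  obtain ⟨hP, H, hH, hV⟩ := hP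
  have hsym : ∀ i k, H i k = H k i := fun i k => by simpa using (hH.1.apply k i)
  -- This is tr(H DᵀD) ≥ 0 for D = P − P₀, from positive semidefiniteness of H applied to each row
  -- of D. No invertibility of H is needed.
  have h1 : 0 ≤ ∑ i, ∑ k, H k i * ⟪P i - P₀ i, P k - P₀ k⟫_ℝ := by
    have h2 : ∑ i, ∑ k, H k i * ⟪P i - P₀ i, P k - P₀ k⟫_ℝ =
        ∑ a, ∑ i, ∑ k, (P i - P₀ i) a * (H i k * (P k - P₀ k) a) := by
      rw [Finset.sum_comm]
      simp only [EuclideanSpace.real_inner_eq_sum, Finset.mul_sum]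
      rw [Finset.sum_congr rfl fun _ _ => Finset.sum_comm, Finset.sum_comm]
      refine Finset.sum_congr rfl fun a _ => ?_
      refine Finset.sum_congr rfl fun i _ => Finset.sum_congr rfl fun k _ => by ring
    rw [h2]
    refine Finset.sum_nonneg fun a _ => ?_
    have := hH.dotProduct_mulVec_nonneg fun i => (P i - P₀ i) a
    simpa [dotProduct, Matrix.mulVec, Finset.mul_sum] using this
  have hPP : ∀ i k, ⟪P i, P k⟫_ℝ = if i = k then 1 else 0 := orthonormal_iff_ite.1 hP
  have hPP₀ : ∀ i k, ⟪P₀ i, P₀ k⟫_ℝ = if i = k then 1 else 0 := orthonormal_iff_ite.1 hP₀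
  -- P and P₀ have the same Gram matrix and H is symmetric, so the quadratic expression collapses to
  -- a linear one in V.
  have h3 : ∑ i, ∑ k, H k i * ⟪P i - P₀ i, P k - P₀ k⟫_ℝ =
      2 * ∑ i, ⟪P i - P₀ i, V i⟫_ℝ := by
    have hsw : ∑ i, ∑ k, H k i * ⟪P i, P₀ k⟫_ℝ = ∑ i, ∑ k, H k i * ⟪P₀ i, P k⟫_ℝ := by
      rw [Finset.sum_comm]
      refine Finset.sum_congr rfl fun i _ => Finset.sum_congr rfl fun k _ => ?_
      rw [hsym, real_inner_comm]
    have e1 : ∑ i, ⟪P i - P₀ i, V i⟫_ℝ =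
        ∑ i, ∑ k, H k i * ⟪P i, P k⟫_ℝ - ∑ i, ∑ k, H k i * ⟪P₀ i, P k⟫_ℝ := by
      rw [← Finset.sum_sub_distrib]
      refine Finset.sum_congr rfl fun i _ => ?_
      rw [hV, inner_sum, ← Finset.sum_sub_distrib]
      refine Finset.sum_congr rfl fun k _ => ?_
      rw [inner_smul_right, inner_sub_left]
      ring
    have e2 : ∑ i, ∑ k, H k i * ⟪P i - P₀ i, P k - P₀ k⟫_ℝ =
        ∑ i, ∑ k, H k i * ⟪P i, P k⟫_ℝ + ∑ i, ∑ k, H k i * ⟪P₀ i, P₀ k⟫_ℝ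
        - ∑ i, ∑ k, H k i * ⟪P i, P₀ k⟫_ℝ - ∑ i, ∑ k, H k i * ⟪P₀ i, P k⟫_ℝ := by
      simp only [← Finset.sum_sub_distrib, ← Finset.sum_add_distrib]
      refine Finset.sum_congr rfl fun i _ => Finset.sum_congr rfl fun k _ => ?_
      rw [inner_sub_left, inner_sub_right, inner_sub_right]
      ring
    rw [e1, e2, hsw]
    simp only [hPP, hPP₀]
    ring
  -- For unit vectors −2⟨P − P₀, P₀⟩ = ‖P − P₀‖²; so subtracting τ P₀ from V produces exactly the
  -- left-hand side.
  have h4 : ∀ i, τ i * ‖P i - P₀ i‖ ^ 2 = - (2 * ⟪P i - P₀ i, τ i • P₀ i⟫_ℝ) := fun i => by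
    rw [norm_sub_sq_real, hP.1, hP₀.1, inner_smul_right, inner_sub_left,
      real_inner_self_eq_norm_sq, hP₀.1]
    ring
  simp only [h4, inner_sub_right, Finset.sum_sub_distrib, Finset.sum_neg_distrib,
    ← Finset.mul_sum]
  linarith

/-- The preceding inequality is quadratic in the column errors on the left and linear on the right.
Applied at the largest column error, one power cancels; the constant 2/δ has δ the smallest τ. -/
theorem near_of_isPolarFactor {τ : Fin R → ℝ} (hτ0 : ∀ i, 0 < τ i)
    {u : Fin R → EuclideanSpace ℝ α} (hu : Orthonormal ℝ u) {s : X → Fin R → ℝ}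
    (hs : ∀ x i, IsSign (s x i)) {V P : X → Fin R → EuclideanSpace ℝ α}
    (hV : ∀ i, Near l g (fun x => V x i) (fun x => (s x i * τ i) • u i))
    (hP : ∀ x, IsPolarFactor (V x) (P x)) (i : Fin R) :
    Near l g (fun x => P x i) (fun x => s x i • u i) := by
  have hsum : Near l g (fun x => ∑ k, ‖V x k - (s x k * τ k) • u k‖) (fun _ => ∑ _k : Fin R, 0) :=
    Near.sum fun k _ => by simpa [Near] using (hV k).norm_left
  obtain ⟨δ, hδ, hδτ⟩ : ∃ δ : ℝ, 0 < δ ∧ ∀ k, δ ≤ τ k := by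
    have : Nonempty (Fin R) := ⟨i⟩
    obtain ⟨k, hk⟩ := Finite.exists_min τ
    exact ⟨τ k, hτ0 k, hk⟩
  refine hsum.norm_le ⟨2 / δ, fun x => ?_⟩
  set D := fun k => P x k - s x k • u k with hD
  set e := fun k => V x k - (s x k * τ k) • u k with he
  have hpos : 0 ≤ ∑ k, ‖e k‖ := Finset.sum_nonneg fun k _ => norm_nonneg _
  rw [Finset.sum_const_zero, sub_zero, Real.norm_of_nonneg hpos]
  have : Nonempty (Fin R) := ⟨i⟩
  obtain ⟨m, hm⟩ := Finite.exists_max fun k => ‖D k‖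
  have h1 := sum_norm_sub_polarFactor_sq_le (τ := τ) (hP x) (hu.isSign_smul (hs x))
  have h2 : δ * ‖D m‖ ^ 2 ≤ ∑ i, τ i * ‖P x i - s x i • u i‖ ^ 2 :=
    (mul_le_mul_of_nonneg_right (hδτ m) (sq_nonneg _)).trans
      (Finset.single_le_sum (f := fun i => τ i * ‖P x i - s x i • u i‖ ^ 2)
        (fun k _ => mul_nonneg (hτ0 k).le (sq_nonneg _)) (Finset.mem_univ m))
  have h3 : ∑ i, ⟪P x i - s x i • u i, V x i - τ i • s x i • u i⟫_ℝ ≤ ‖D m‖ * ∑ k, ‖e k‖ := by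
    rw [Finset.mul_sum]
    refine Finset.sum_le_sum fun k _ => (real_inner_le_norm _ _).trans ?_
    rw [smul_smul, mul_comm (τ k)]
    exact mul_le_mul_of_nonneg_right (hm k) (norm_nonneg _)
  refine (hm i).trans ?_
  rcases (norm_nonneg (D m)).eq_or_lt with h0 | h0
  · exact h0.symm.le.trans (mul_nonneg (div_pos two_pos hδ).le hpos)
  · rw [div_mul_eq_mul_div, le_div_iff₀ hδ]
    refine le_of_mul_le_mul_right ?_ h0
    have h4 := h2.trans (h1.trans (mul_le_mul_of_nonneg_left h3 zero_le_two))
    calc ‖D m‖ * δ * ‖D m‖ = δ * ‖D m‖ ^ 2 := by ring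
      _ ≤ 2 * (‖D m‖ * ∑ k, ‖e k‖) := h4
      _ = 2 * (∑ k, ‖e k‖) * ‖D m‖ := by ring

end Perturbation

/-! ### The extraction rules on perturbed rank-1 matrices -/

section GetV

variable {X : Type*} {γ : Type} [Fintype γ] {m : ℕ} {l : Filter X} {g : X → ℝ}

theorem norm_normalize_le_one {E : Type*} [NormedAddCommGroup E] [NormedSpace ℝ E] (r : E) :
    ‖‖r‖⁻¹ • r‖ ≤ 1 := by
  rw [norm_smul, norm_inv, norm_norm]
  exact inv_mul_le_one

/-- The lower bound on the chosen row carries an error term, so no smallness of the noise is needed: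
where the row could be nearly zero, the noise is itself of order one. The factor 2 is what the
largest-row rule produces. -/
theorem near_normalize_row {c : X → ℝ} {u : EuclideanSpace ℝ (Fin m)} {w : EuclideanSpace ℝ γ}
    (hw : ‖w‖ = 1) {M : X → Matrix (Fin m) γ ℝ}
    (hM : ∀ a b, Near l g (fun x => M x a b) (fun x => c x * (u a * w b)))
    (b : X → Fin m) {δ : ℝ} (hδ : 0 < δ)
    (hb : ∀ x, δ ≤ |c x * u (b x)| + 2 * ∑ a, ‖rowE (M x) a - (c x * u a) • w‖) :
    ∃ s : X → ℝ, (∀ x, IsSign (s x)) ∧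
      Near l g (fun x => ‖rowE (M x) (b x)‖⁻¹ • rowE (M x) (b x)) (fun x => s x • w) := by
  have he : Near l g (fun x => ∑ a, ‖rowE (M x) a - (c x * u a) • w‖)
      (fun _ => ∑ _a : Fin m, 0) := Near.sum fun a _ => by
    have : Near l g (fun x => rowE (M x) a) (fun x => (c x * u a) • w) :=
      near_iff_apply.2 fun b => by simpa [rowE, mul_assoc] using hM a b
    simpa [Near] using this.norm_left
  choose s hs hs' using fun x => exists_isSign_norm_normalize_sub_le (rowE (M x) (b x)) w hw
    (c x * u (b x))
  refine ⟨s, hs, he.norm_le ⟨6 / δ, fun x => ?_⟩⟩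
  have h1 := hs' x
  have h2 := hb x
  have h3 : ‖rowE (M x) (b x) - (c x * u (b x)) • w‖ ≤
      ∑ a, ‖rowE (M x) a - (c x * u a) • w‖ :=
    Finset.single_le_sum (f := fun a => ‖rowE (M x) a - (c x * u a) • w‖)
      (fun a _ => norm_nonneg _) (Finset.mem_univ _)
  have h4 := norm_normalize_le_one (rowE (M x) (b x))
  have h5 : ‖s x • w‖ = 1 := by rw [norm_smul, hw, Real.norm_eq_abs, (hs x).abs, one_mul]
  have h6 := norm_sub_le (‖rowE (M x) (b x)‖⁻¹ • rowE (M x) (b x)) (s x • w)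
  have h7 := norm_nonneg (‖rowE (M x) (b x)‖⁻¹ • rowE (M x) (b x) - s x • w)
  have h8 : 0 ≤ ∑ a, ‖rowE (M x) a - (c x * u a) • w‖ :=
    Finset.sum_nonneg fun a _ => norm_nonneg _
  rw [Finset.sum_const_zero, sub_zero, Real.norm_of_nonneg h8, div_mul_eq_mul_div,
    le_div_iff₀ hδ]
  generalize ‖‖rowE (M x) (b x)‖⁻¹ • rowE (M x) (b x) - s x • w‖ = D at *
  generalize ∑ a, ‖rowE (M x) a - (c x * u a) • w‖ = e at *
  -- With D the distance and e the total row error, |c u_b| D ≤ 2e and D ≤ 2 give δD ≤ 2e + 2eD ≤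
  -- 6e, the source of the constant 6/δ.
  have h9 := mul_le_mul_of_nonneg_right h2 h7
  have h10 : e * D ≤ e * 2 := mul_le_mul_of_nonneg_left (by linarith) h8
  linarith

theorem orthonormal_fin_one {E : Type*} [NormedAddCommGroup E] [InnerProductSpace ℝ E] {u : E}
    (hu : ‖u‖ = 1) : Orthonormal ℝ fun _ : Fin 1 => u :=
  ⟨fun _ => hu, fun i k hik => (hik (Subsingleton.elim i k)).elim⟩

theorem exists_pos_le_abs {κ : Type*} [Finite κ] (u : κ → ℝ) :
    ∃ δ, 0 < δ ∧ ∀ a, u a ≠ 0 → δ ≤ |u a| := by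
  rcases isEmpty_or_nonempty {a // u a ≠ 0} with h | h
  · exact ⟨1, one_pos, fun a ha => (h.false ⟨a, ha⟩).elim⟩
  · obtain ⟨a, ha⟩ := Finite.exists_min fun a : {a // u a ≠ 0} => |u a|
    exact ⟨|u a|, abs_pos.2 a.2, fun b hb => ha ⟨b, hb⟩⟩

/-- Every extraction procedure, applied to a perturbed rank-1 matrix `c u wᵀ`, returns `|c| u`
up to sign and an error of the order of the perturbation. -/
theorem near_of_isGetV (hg : g =O[l] fun _ => (1 : ℝ)) {c : X → ℝ} {τ : ℝ}
    (hc : ∀ x, |c x| = τ) (hτ : 0 < τ) {u : EuclideanSpace ℝ (Fin m)} {w : EuclideanSpace ℝ γ}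
    (hu : ‖u‖ = 1) (hw : ‖w‖ = 1) {M : X → Matrix (Fin m) γ ℝ}
    (hM : ∀ a b, Near l g (fun x => M x a b) (fun x => c x * (u a * w b)))
    {proc : GetVProc} {k : X → Fin m} (hk : proc = GetVProc.C → ∀ x, u (k x) ≠ 0)
    {v : X → EuclideanSpace ℝ (Fin m)} (hv : ∀ x, IsGetV proc (k x) (M x) (v x)) :
    ∃ s : X → ℝ, (∀ x, IsSign (s x)) ∧ Near l g v (fun x => (s x * τ) • u) := by
  have hM' : ∀ a b, Near l g (fun x => M x a b)
      (fun x => sumOuterMatrix (fun _ : Fin 1 => c x) (fun _ => u) (fun _ => w) a b) := by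
    intro a b
    simpa [sumOuterMatrix] using hM a b
  -- It is enough that the multiplying vector is close to ±w: the matrix then sends it close to ±c
  -- u.
  suffices h : ∃ y : X → EuclideanSpace ℝ γ, (∀ x, v x = mulE (M x) (y x)) ∧
      ∃ s : X → ℝ, (∀ x, IsSign (s x)) ∧ Near l g y (fun x => s x • w) by
    obtain ⟨y, hvy, s, hs, hy⟩ := h
    choose r hr hcr using fun x => exists_isSign_mul_abs (c x)
    refine ⟨fun x => r x * s x, fun x => (hr x).mul (hs x), ?_⟩
    have e := Near.mulE hg hM' hy
      (bounded_one_sumOuterMatrix (τ := fun _ => τ) (fun x _ => hc x) _ _)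
      (bounded_one_of_le 1 fun x => by rw [norm_smul, hw, Real.norm_eq_abs, (hs x).abs, one_mul])
    rw [show v = fun x => mulE (M x) (y x) from funext hvy]
    convert e using 2 with x
    rw [mulE_sumOuterMatrix, Fin.sum_univ_one, inner_smul_right, real_inner_self_eq_norm_sq, hw]
    conv_rhs => rw [hcr x, hc x]
    ring_nf
  cases proc with
  | A =>
    choose y hy hvy using hv
    refine ⟨y, hvy, ?_⟩
    -- The case R = 1 of singular vector stability for the transpose; the simplicity of the singular
    -- value is then vacuous.
    obtain ⟨s, hs, h⟩ := near_of_isLeadingLeftSingular (σ := fun x (_ : Fin 1) => c x)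
      (τ := fun _ => τ) hg (fun x _ => hc x) (Subsingleton.strictAnti _) (fun _ => hτ)
      (orthonormal_fin_one hw) (orthonormal_fin_one hu) (M := fun x => (M x).transpose)
      (fun a b => by
        simp only [← transpose_sumOuterMatrix _ (fun _ : Fin 1 => u)]
        exact hM' b a) hy
    exact ⟨fun x => s x 0, fun x => hs x 0, h 0⟩
  | B =>
    choose b hb _ hvb using hv
    refine ⟨_, hvb, ?_⟩
    obtain ⟨a₀, ha₀⟩ : ∃ a, u a ≠ 0 := by
      by_contra! h
      have : u = 0 := by ext a; simpa using h a
      simp [this] at hu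
    -- The chosen row is at least as long as row `a₀`, and passing to noise-free lengths costs one
    -- error for each of the two rows.
    refine near_normalize_row hw hM b (δ := τ * |u a₀|) (mul_pos hτ (abs_pos.2 ha₀)) fun x => ?_
    have hle : ∀ a, ‖rowE (M x) a - (c x * u a) • w‖ ≤
        ∑ a, ‖rowE (M x) a - (c x * u a) • w‖ := fun a =>
      Finset.single_le_sum (f := fun a => ‖rowE (M x) a - (c x * u a) • w‖)
        (fun a _ => norm_nonneg _) (Finset.mem_univ _)
    have hn : ∀ a, |‖rowE (M x) a‖ - (|c x * u a|)| ≤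
        ‖rowE (M x) a - (c x * u a) • w‖ := fun a => by
      simpa [norm_smul, hw] using abs_norm_sub_norm_le (rowE (M x) a) ((c x * u a) • w)
    have h1 := abs_le.1 ((hn a₀).trans (hle a₀))
    have h2 := abs_le.1 ((hn (b x)).trans (hle (b x)))
    have h3 := hb x a₀
    rw [← hc x, ← abs_mul]
    linarith [h1.1, h2.2]
  | C =>
    refine ⟨_, hv, ?_⟩
    -- The smallest nonzero |u a| bounds the drawn entry below, uniformly over the admissible draws.
    obtain ⟨δ, hδ, hδu⟩ := exists_pos_le_abs u
    refine near_normalize_row hw hM k (mul_pos hτ hδ) fun x => ?_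
    have h1 := mul_le_mul_of_nonneg_left (hδu _ (hk rfl x)) hτ.le
    have h2 : 0 ≤ ∑ a, ‖rowE (M x) a - (c x * u a) • w‖ :=
      Finset.sum_nonneg fun a _ => norm_nonneg _
    rw [abs_mul, hc x]
    linarith

end GetV

/-! ### Rank-1 tensors and quasi-optimal approximation -/

section Outer

variable {ι : Type} [Fintype ι] [LinearOrder ι] {n : ι → ℕ}

theorem inner_outer (u v : (l : ι) → EuclideanSpace ℝ (Fin (n l))) :
    ⟪outer u, outer v⟫_ℝ = ∏ l, ⟪u l, v l⟫_ℝ := by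
  simp only [EuclideanSpace.real_inner_eq_sum, outer, ← Finset.prod_mul_distrib,
    Finset.prod_univ_sum, Fintype.piFinset_univ]

theorem norm_outer_of_norm_one {u : (l : ι) → EuclideanSpace ℝ (Fin (n l))}
    (hu : ∀ l, ‖u l‖ = 1) : ‖outer u‖ = 1 := by
  have : ‖outer u‖ ^ 2 = 1 := by
    rw [← real_inner_self_eq_norm_sq, inner_outer]
    simp [hu]
  exact (pow_eq_one_iff_of_nonneg (norm_nonneg _) two_ne_zero).1 this

theorem inner_sum_smul_outer {R : ℕ} (σ : Fin R → ℝ) (U : Factors n R)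
    (v : (l : ι) → EuclideanSpace ℝ (Fin (n l))) :
    ⟪∑ i, σ i • outer (fun l => U l i), outer v⟫_ℝ = ∑ i, σ i * ∏ l, ⟪U l i, v l⟫_ℝ := by
  simp [sum_inner, inner_smul_left, inner_outer]

/-- The inner product of two rank-1 tensors is the product of the modewise cosines, so in absolute
value it is at most the cosine in mode `j`; for unit vectors a larger cosine means a smaller
distance. -/
theorem exists_isSign_norm_sub_le_norm_outer_sub {u v : (l : ι) → EuclideanSpace ℝ (Fin (n l))}
    (hu : ∀ l, ‖u l‖ = 1) (hv : ∀ l, ‖v l‖ = 1) {r : ℝ} (hr : IsSign r) (j : ι) :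
    ∃ s, IsSign s ∧ ‖v j - s • u j‖ ≤ ‖outer u - r • outer v‖ := by
  obtain ⟨s, hs, hc⟩ := exists_isSign_mul_abs ⟪v j, u j⟫_ℝ
  refine ⟨s, hs, le_of_sq_le_sq ?_ (norm_nonneg _)⟩
  have h1 : ⟪outer u, outer v⟫_ℝ * r ≤ |⟪v j, u j⟫_ℝ| := by
    refine (le_abs_self _).trans ?_
    rw [abs_mul, hr.abs, mul_one, inner_outer, Finset.abs_prod,
      ← Finset.mul_prod_erase _ _ (Finset.mem_univ j), real_inner_comm]
    refine mul_le_of_le_one_right (abs_nonneg _)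
      (Finset.prod_le_one (fun l _ => abs_nonneg _) fun l _ => ?_)
    simpa [hu, hv] using abs_real_inner_le_norm (u l) (v l)
  have h2 : ⟪v j, u j⟫_ℝ * s = |⟪v j, u j⟫_ℝ| := by
    conv_lhs => rw [hc, mul_right_comm, hs.mul_self, one_mul]
  rw [norm_sub_sq_real, norm_sub_sq_real, norm_smul, norm_smul, norm_outer_of_norm_one hu,
    norm_outer_of_norm_one hv, hu, hv, Real.norm_eq_abs, Real.norm_eq_abs, hs.abs, hr.abs,
    inner_smul_right, inner_smul_right, mul_comm s, mul_comm r, h2]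
  linarith

theorem prod_eq_prod_lt_mul_mul_prod_gt (F : ι → ℝ) (j : ι) :
    ∏ l, F l = (∏ l : {l : ι // l < j}, F l) * F j * ∏ l with j < l, F l := by
  rw [← Fintype.prod_subtype_mul_prod_subtype (fun l => l < j) F, mul_assoc]
  congr 1
  rw [← Finset.prod_subtype (Finset.univ.filter fun l => ¬ l < j) (by simp) F,
    ← Finset.mul_prod_erase _ _ (by simp : j ∈ Finset.univ.filter fun l => ¬ l < j)]
  congr 2
  ext l
  simp only [Finset.mem_filter, Finset.mem_univ, Finset.mem_erase, true_and, not_lt]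
  exact ⟨fun h => lt_of_le_of_ne h.2 h.1.symm, fun h => ⟨h.ne', h.le⟩⟩

/-- Testing quasi-optimality against `c • outer u` and using the triangle inequality gives the
factor 1 + κ. Dividing by |c| = τ normalizes, and replacing the remaining coefficient by a sign
gives the 2. -/
theorem exists_isSign_norm_sub_le_of_isQuasiOptimalRank1 {κ τ c : ℝ} (hτ : 0 < τ)
    (hc : |c| = τ) {u v : (l : ι) → EuclideanSpace ℝ (Fin (n l))} (hu : ∀ l, ‖u l‖ = 1)
    {T : Tensor n} (hv : IsQuasiOptimalRank1 κ T v) (j : ι) :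
    ∃ s, IsSign s ∧ ‖v j - s • u j‖ ≤ 2 * ((1 + κ) / τ) * ‖T - c • outer u‖ := by
  have hc0 : c ≠ 0 := abs_pos.1 (hc ▸ hτ)
  set a := ⟪T, outer v⟫_ℝ
  obtain ⟨r, hr, h1⟩ := exists_isSign_norm_sub_le (norm_outer_of_norm_one hu)
    (norm_outer_of_norm_one hv.1) (a / c)
  obtain ⟨s, hs, h2⟩ := exists_isSign_norm_sub_le_norm_outer_sub hu hv.1 hr j
  refine ⟨s, hs, (h2.trans h1).trans ?_⟩
  rw [mul_assoc, div_mul_eq_mul_div]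
  gcongr
  rw [le_div_iff₀ hτ]
  have h3 : ‖outer u - (a / c) • outer v‖ * τ = ‖c • outer u - a • outer v‖ := by
    rw [← hc, mul_comm, ← Real.norm_eq_abs, ← norm_smul, smul_sub, smul_smul,
      mul_div_cancel₀ _ hc0]
  have h4 := norm_sub_le_norm_sub_add_norm_sub (c • outer u) T (a • outer v)
  have h5 := hv.2 c u
  rw [norm_sub_rev (c • outer u) T] at h4
  rw [h3]
  linarith

end Outer

/-! ### Contraction isolates a single component -/

section Contraction

variable {X : Type*} {l : Filter X} {g : X → ℝ} {ι : Type} {n : ι → ℕ} {R : ℕ}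

/-- One contracted mode with orthonormal true factors suffices to annihilate all terms k ≠ i; the
other contracted modes need only unit columns and contribute bounded factors. -/
theorem near_sum_mul_prod_inner (hg : g =O[l] fun _ => (1 : ℝ)) {σ : X → Fin R → ℝ}
    {τ : Fin R → ℝ} (hσ : ∀ x i, |σ x i| = τ i) {U : Factors n R} {t : Finset ι} {i : Fin R}
    (hU : ∃ j ∈ t, Orthonormal ℝ (U j)) (hU1 : ∀ l i, ‖U l i‖ = 1)
    {s : X → ι → ℝ} (hs : ∀ x, ∀ j ∈ t, IsSign (s x j))
    {v : X → (l : ι) → EuclideanSpace ℝ (Fin (n l))}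
    (hv : ∀ j ∈ t, Near l g (fun x => v x j) (fun x => s x j • U j i)) (a : Fin R → ℝ) :
    Near l g (fun x => ∑ k, σ x k * (a k * ∏ j ∈ t, ⟪U j k, v x j⟫_ℝ))
      (fun x => σ x i * (a i * ∏ j ∈ t, s x j)) := by
  have hb : ∀ j ∈ t, (fun x => s x j • U j i) =O[l] fun _ => (1 : ℝ) := fun j hj =>
    bounded_one_of_le 1 fun x => by
      rw [norm_smul, hU1, Real.norm_eq_abs, (hs x j hj).abs, one_mul]
  have hc : ∀ k, ∀ j ∈ t, (fun x => ⟪U j k, s x j • U j i⟫_ℝ) =O[l] fun _ => (1 : ℝ) :=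
    fun k j hj => bounded_one_of_le 1 fun x => (norm_inner_le_norm _ _).trans <| by
      rw [norm_smul, hU1, hU1, Real.norm_eq_abs, (hs x j hj).abs, one_mul, one_mul]
  have e := Near.sum (s := Finset.univ) fun (k : Fin R) _ =>
    Near.mul hg (Near.refl fun x => σ x k)
      (Near.const_mul (Near.prod hg
        (fun j hj => Near.inner hg (Near.refl fun _ => U j k) (hv j hj)
          (bounded_one_of_le 1 fun _ => (hU1 j k).le) (hb j hj)) (hc k)) (a k))
      (bounded_one_of_le _ fun x => (hσ x k).le)
      ((bounded_one_prod (hc k)).const_mul_left (a k))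
  convert e using 2 with x
  rw [Finset.sum_eq_single i]
  · congr 2
    refine Finset.prod_congr rfl fun j _ => ?_
    rw [inner_smul_right, real_inner_self_eq_norm_sq, hU1]
    norm_num
  · intro k _ hk
    obtain ⟨j, hj, hUj⟩ := hU
    rw [Finset.prod_eq_zero hj, mul_zero, mul_zero]
    rw [inner_smul_right, hUj.2 hk, mul_zero]
  · simp

end Contraction

/-! ### The orthonormal phase -/

section Phase

variable {X : Type*} {l : Filter X} {g : X → ℝ}
variable {ι : Type} [Fintype ι] [LinearOrder ι] {n : ι → ℕ} {R : ℕ}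

theorem near_inner_outer {A B : X → Tensor n} (hA : Near l g A B)
    {v : X → (l : ι) → EuclideanSpace ℝ (Fin (n l))} (hv : ∀ x l, ‖v x l‖ = 1) :
    Near l g (fun x => ⟪A x, outer (v x)⟫_ℝ) (fun x => ⟪B x, outer (v x)⟫_ℝ) := by
  refine hA.norm_le ⟨1, fun x => ?_⟩
  rw [← inner_sub_left, one_mul]
  simpa [norm_outer_of_norm_one (hv x)] using norm_inner_le_norm (𝕜 := ℝ) (A x - B x) (outer (v x))

theorem unfolding_sum_smul_outer (σ : Fin R → ℝ) (U : Factors n R)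
    (u : (l : ι) → EuclideanSpace ℝ (Fin (n l))) (j : ι) (a : Fin (n j))
    (b : (l : {l : ι // l < j}) → Fin (n l)) :
    unfolding (∑ i, σ i • outer (fun l => U l i)) u j a b =
      ∑ k, σ k * ((U j k a * outer (fun l : {l : ι // l < j} => U l k) b) *
        ∏ l with j < l, ⟪U l k, u l⟫_ℝ) := by
  rw [unfolding, inner_sum_smul_outer]
  refine Finset.sum_congr rfl fun k _ => ?_
  rw [prod_eq_prod_lt_mul_mul_prod_gt _ j, mul_comm (U j k a)]
  congr 2
  · congr 1
    · refine Finset.prod_congr rfl fun m _ => ?_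
      simp [m.2, EuclideanSpace.inner_single_right]
    · simp [EuclideanSpace.inner_single_right]
  · refine Finset.prod_congr rfl fun m hm => ?_
    have hm : j < m := by simpa using hm
    simp [hm.not_gt, hm.ne']

theorem near_unfolding {A B : X → Tensor n} (hA : Near l g A B)
    {u : X → (l : ι) → EuclideanSpace ℝ (Fin (n l))} {j : ι} (hu : ∀ x m, j < m → ‖u x m‖ = 1)
    (a : Fin (n j)) (b : (l : {l : ι // l < j}) → Fin (n l)) :
    Near l g (fun x => unfolding (A x) (u x) j a b) (fun x => unfolding (B x) (u x) j a b) := by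
  refine near_inner_outer hA fun x m => ?_
  split_ifs with h1 h2
  · simp
  · simp
  · exact hu x m (lt_of_le_of_ne (not_lt.1 h1) (Ne.symm h2))

theorem contract_sum_smul_outer (O : ι → Prop) [DecidablePred O] (σ : Fin R → ℝ)
    (U : Factors n R) (u : (l : ι) → EuclideanSpace ℝ (Fin (n l)))
    (b : (l : {l : ι // ¬ O l}) → Fin (n l)) :
    contract O (∑ i, σ i • outer (fun l => U l i)) u b =
      ∑ k, σ k * (outer (fun l : {l : ι // ¬ O l} => U l k) b *
        ∏ l with O l, ⟪U l k, u l⟫_ℝ) := by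
  simp only [contract]
  rw [inner_sum_smul_outer]
  refine Finset.sum_congr rfl fun k _ => ?_
  rw [← Fintype.prod_subtype_mul_prod_subtype O, mul_comm (outer _ b),
    Finset.prod_subtype (Finset.univ.filter fun l => O l) (p := O) (by simp)]
  congr 2
  · refine Finset.prod_congr rfl fun m _ => ?_
    simp [m.2]
  · refine Finset.prod_congr rfl fun m _ => ?_
    simp [m.2, EuclideanSpace.inner_single_right]

theorem near_contract (hg : g =O[l] fun _ => (1 : ℝ)) {σ : X → Fin R → ℝ}
    {τ : Fin R → ℝ} (hσ : ∀ x i, |σ x i| = τ i) {O : ι → Prop} [DecidablePred O]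
    {U : Factors n R} (hU1 : ∀ l i, ‖U l i‖ = 1) (hU : ∃ j, O j ∧ Orthonormal ℝ (U j))
    {A : X → Tensor n} (hA : Near l g A fun x => ∑ i, σ x i • outer fun l => U l i)
    {i : Fin R} {s : X → ι → ℝ} (hs : ∀ x j, O j → IsSign (s x j))
    {u : X → (l : ι) → EuclideanSpace ℝ (Fin (n l))} (hu1 : ∀ x l, O l → ‖u x l‖ = 1)
    (hu : ∀ j, O j → Near l g (fun x => u x j) (fun x => s x j • U j i)) :
    Near l g (fun x => contract O (A x) (u x))
      (fun x => (σ x i * ∏ j with O j, s x j) • outer fun l : {l : ι // ¬ O l} => U l i) := by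
  rw [near_iff_apply]
  intro b
  have e1 : Near l g (fun x => contract O (A x) (u x) b)
      (fun x => contract O (∑ i, σ x i • outer fun l => U l i) (u x) b) := by
    refine near_inner_outer hA fun x m => ?_
    split_ifs with h
    · exact hu1 x m h
    · simp
  simp only [contract_sum_smul_outer] at e1
  refine e1.trans ?_
  have e2 := near_sum_mul_prod_inner hg hσ (t := Finset.univ.filter fun l => O l)
    (by simpa using hU) hU1 (fun x j hj => hs x j (by simpa using hj))
    (fun j hj => hu j (by simpa using hj)) (fun k => outer (fun l : {l : ι // ¬ O l} => U l k) b)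
  convert e2 using 2 with x
  simp only [PiLp.smul_apply, smul_eq_mul]
  ring

theorem OrthonormalPhase.orthonormal {proc : GetVProc} {O : ι → Prop}
    {k : (l : ι) → Fin R → Fin (n l)} {A : Tensor n} {U : Factors n R}
    (h : OrthonormalPhase proc O k A U) {j : ι} (hj : O j) : Orthonormal ℝ (U j) := by
  by_cases ht : IsTop j
  · exact (h.last j ht fun _ => 0).1
  · obtain ⟨V, -, -, h⟩ := h.step j hj ht
    exact h.1

/-- The factors computed in the first phase are the true factors, up to signs and an error of the
order of the noise. -/
theorem near_of_orthonormalPhase (hg : g =O[l] fun _ => (1 : ℝ)) {σ : X → Fin R → ℝ}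
    {τ : Fin R → ℝ} (hσ : ∀ x i, |σ x i| = τ i) (hτ : StrictAnti τ) (hτ0 : ∀ i, 0 < τ i)
    {O : ι → Prop} (hO : ∀ j m, O j → j < m → O m)
    {U : Factors n R} (hU1 : ∀ l i, ‖U l i‖ = 1) (hU : ∀ j, O j → Orthonormal ℝ (U j))
    (hw : ∀ j, IsTop j → Orthonormal ℝ fun i => outer fun l : {l : ι // l < j} => U l i)
    {A : X → Tensor n} (hA : Near l g A fun x => ∑ i, σ x i • outer fun l => U l i)
    {proc : GetVProc} {k : X → (l : ι) → Fin R → Fin (n l)}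
    (hk : proc = GetVProc.C → ∀ x j i, O j → U j i (k x j i) ≠ 0) {U₀ : X → Factors n R}
    (hU₀ : ∀ x, OrthonormalPhase proc O (k x) (A x) (U₀ x)) (j : ι) (hj : O j) :
    ∃ s : X → Fin R → ℝ, (∀ x i, IsSign (s x i)) ∧
      ∀ i, Near l g (fun x => U₀ x j i) (fun x => s x i • U j i) := by
  -- Induction runs downwards, in the order in which the algorithm computes the factors.
  induction j using WellFoundedGT.induction with
  | ind j ih =>
  by_cases ht : IsTop j
  · have hgt : (Finset.univ.filter fun m => j < m) = ∅ := by
      simp [fun m => (ht m).not_gt]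
    refine near_of_isLeadingLeftSingular hg hσ hτ hτ0 (hU j hj) (hw j ht) (fun a b => ?_)
      fun x => (hU₀ x).last j ht fun _ => 0
    -- At the last mode nothing is contracted, so the vectors supplied are irrelevant and zero
    -- serves as a filler.
    have := near_unfolding hA (u := fun _ _ => 0) (j := j)
      (fun x m hm => absurd hm (ht m).not_gt) a b
    simpa [unfolding_sum_smul_outer, hgt, sumOuterMatrix] using this
  -- The signs matter only for modes above `j`; elsewhere 0 is a filler making the choice total.
  · have ih' : ∀ m, ∃ s : X → Fin R → ℝ, j < m → (∀ x i, IsSign (s x i)) ∧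
        ∀ i, Near l g (fun x => U₀ x m i) (fun x => s x i • U m i) := fun m => by
      by_cases hm : j < m
      · obtain ⟨s, hs⟩ := ih m hm (hO j m hj hm)
        exact ⟨s, fun _ => hs⟩
      · exact ⟨fun _ _ => 0, fun h => absurd h hm⟩
    choose s hs using ih'
    -- The coefficient left after contraction: σ_i times the signs of the factors already computed.
    set c : Fin R → X → ℝ := fun i x => σ x i * ∏ m with j < m, s m x i with hcdef
    have hc : ∀ i x, |c i x| = τ i := fun i x => by
      have : IsSign (∏ m with j < m, s m x i) :=
        IsSign.prod fun m hm => (hs m (by simpa using hm)).1 x i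
      rw [hcdef]
      simp only [abs_mul, hσ, this.abs, mul_one]
    have hM : ∀ i a b, Near l g (fun x => unfolding (A x) (fun l => U₀ x l i) j a b)
        (fun x => c i x * (U j i a * outer (fun l : {l : ι // l < j} => U l i) b)) := by
      intro i a b
      have e1 := near_unfolding hA (u := fun x m => U₀ x m i) (j := j)
        (fun x m hm => ((hU₀ x).orthonormal (hO j m hj hm)).1 i) a b
      simp only [unfolding_sum_smul_outer] at e1
      obtain ⟨m, hm⟩ : ∃ m, j < m := by simpa [IsTop] using ht
      have e2 := near_sum_mul_prod_inner hg hσ (t := Finset.univ.filter fun m => j < m) (i := i)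
        ⟨m, by simpa using hm, hU m (hO j m hj hm)⟩ hU1 (s := fun x m => s m x i)
        (fun x m hm => (hs m (by simpa using hm)).1 x i) (v := fun x m => U₀ x m i)
        (fun m hm => (hs m (by simpa using hm)).2 i)
        (fun k => U j k a * outer (fun l : {l : ι // l < j} => U l k) b)
      refine e1.trans ?_
      convert e2 using 2 with x
      rw [hcdef]
      ring
    choose V hVbot hV hP using fun x => (hU₀ x).step j hj ht
    have hVn : ∀ i, ∃ r : X → ℝ, (∀ x, IsSign (r x)) ∧
        Near l g (fun x => V x i) (fun x => (r x * τ i) • U j i) := fun i => by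
      by_cases hb : IsBot j
      -- Below the first mode there are no modes, so the unfolding has one column and that column is
      -- used directly.
      · have : IsEmpty {l : ι // l < j} := ⟨fun m => (hb m).not_gt m.2⟩
        choose r hr hcr using fun x => exists_isSign_mul_abs (c i x)
        refine ⟨r, hr, near_iff_apply.2 fun a => ?_⟩
        have e := Near.sum (s := Finset.univ) fun b _ => hM i a b
        convert e using 2 with x x
        · rw [hVbot x i hb]
          simp [mulE]
        · simp only [Fintype.sum_unique, outer, Finset.univ_eq_empty, Finset.prod_empty, mul_one,
            PiLp.smul_apply, smul_eq_mul]
          rw [hcr x, hc]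
      · exact near_of_isGetV hg (hc i) (hτ0 i) (hU1 j i)
          (norm_outer_of_norm_one fun l : {l : ι // l < j} => hU1 l i) (hM i)
          (k := fun x => k x j i) (fun h x => hk h x j i hj) fun x => hV x i hb
    choose r hr hVr using hVn
    exact ⟨fun x i => r i x, fun x i => hr i x,
      near_of_isPolarFactor hτ0 (hU j hj) (fun x i => hr i x) hVr hP⟩

end Phase

/-! ### Compactness, the noise-free optimum and its perturbation -/

theorem isCompact_setOf_feasible {ι : Type} {n : ι → ℕ} {R : ℕ} (O : ι → Prop) :
    IsCompact {U : Factors n R | Feasible O U} := by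
  have h1 : IsCompact (Set.univ.pi fun l => Set.univ.pi fun _ : Fin R =>
      Metric.sphere (0 : EuclideanSpace ℝ (Fin (n l))) 1) :=
    isCompact_univ_pi fun l => isCompact_univ_pi fun _ => isCompact_sphere _ _
  refine h1.of_isClosed_subset ?_ fun U hU l _ i _ => by simpa using hU.1 l i
  simp only [Feasible, Set.ofPred_and, Set.ofPred_forall]
  refine IsClosed.inter (isClosed_iInter fun l => isClosed_iInter fun i =>
    isClosed_eq (by fun_prop) continuous_const)
    (isClosed_iInter fun l => isClosed_iInter fun _ => ?_)
  simp only [orthonormal_iff_ite, Set.ofPred_forall]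
  exact isClosed_iInter fun i => isClosed_iInter fun k =>
    isClosed_eq (by fun_prop) continuous_const

section Objective

variable {ι : Type} [Fintype ι] [LinearOrder ι] {n : ι → ℕ} {R : ℕ}

theorem abs_inner_le_one_of_norm_one {E : Type*} [NormedAddCommGroup E] [InnerProductSpace ℝ E]
    {u v : E} (hu : ‖u‖ = 1) (hv : ‖v‖ = 1) : |⟪u, v⟫_ℝ| ≤ 1 := by
  simpa [hu, hv] using abs_real_inner_le_norm u v

theorem Orthonormal.sum_sq_inner_le_one {E : Type*} [NormedAddCommGroup E]
    [InnerProductSpace ℝ E] {u : Fin R → E} (hu : Orthonormal ℝ u) {v : E} (hv : ‖v‖ = 1) :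
    ∑ i, ⟪u i, v⟫_ℝ ^ 2 ≤ 1 := by
  simpa [hv] using hu.sum_inner_products_le (s := Finset.univ) v

/-- Without noise, no feasible point has a larger objective value than the true factors. -/
theorem objective_sum_smul_outer_le (σ : Fin R → ℝ) {O : ι → Prop} {p q : ι} (hpq : p ≠ q)
    (hp : O p) (hq : O q) {U W : Factors n R} (hU : Feasible O U) (hW : Feasible O W) :
    objective (∑ i, σ i • outer fun l => U l i) W ≤ ∑ i, σ i ^ 2 := by
  have h1 : ∀ i, ⟪∑ k, σ k • outer (fun l => U l k), outer fun l => W l i⟫_ℝ ^ 2 ≤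
      ∑ k, σ k ^ 2 * ⟪U p k, W p i⟫_ℝ ^ 2 := fun i => by
    -- Two orthonormal modes are split off. Cauchy–Schwarz in `k` separates them; Bessel in mode `q`
    -- absorbs one factor together with the bounded remainder `r`.
    have hr : ∀ k, ∃ r : ℝ, r ^ 2 ≤ 1 ∧
        ∏ l, ⟪U l k, W l i⟫_ℝ = ⟪U p k, W p i⟫_ℝ * (⟪U q k, W q i⟫_ℝ * r) := fun k => by
      refine ⟨∏ l ∈ (Finset.univ.erase p).erase q, ⟪U l k, W l i⟫_ℝ, ?_, ?_⟩
      · rw [sq_le_one_iff_abs_le_one, Finset.abs_prod]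
        exact Finset.prod_le_one (fun _ _ => abs_nonneg _) fun l _ =>
          abs_inner_le_one_of_norm_one (hU.1 l k) (hW.1 l i)
      · rw [Finset.mul_prod_erase _ (fun l => ⟪U l k, W l i⟫_ℝ)
            (by simp [hpq.symm] : q ∈ Finset.univ.erase p),
          Finset.mul_prod_erase _ (fun l => ⟪U l k, W l i⟫_ℝ) (Finset.mem_univ p)]
    choose r hr hr' using hr
    rw [inner_sum_smul_outer]
    have h2 := Finset.sum_mul_sq_le_sq_mul_sq Finset.univ
      (fun k => σ k * ⟪U p k, W p i⟫_ℝ) (fun k => ⟪U q k, W q i⟫_ℝ * r k)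
    have h3 : ∑ k, (⟪U q k, W q i⟫_ℝ * r k) ^ 2 ≤ 1 := by
      refine le_trans (Finset.sum_le_sum fun k _ => ?_)
        ((hU.2 q hq).sum_sq_inner_le_one (hW.1 q i))
      rw [mul_pow]
      exact mul_le_of_le_one_right (sq_nonneg _) (hr k)
    have h4 := mul_le_of_le_one_right
      (Finset.sum_nonneg (s := Finset.univ)
        fun k _ => sq_nonneg (σ k * ⟪U p k, W p i⟫_ℝ)) h3
    simp only [hr']
    have h5 := h2.trans h4
    simpa only [mul_pow, mul_assoc] using h5
  refine (Finset.sum_le_sum fun i _ => h1 i).trans ?_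
  rw [Finset.sum_comm]
  refine Finset.sum_le_sum fun k _ => ?_
  rw [← Finset.mul_sum]
  simp only [real_inner_comm (W p _)]
  -- After exchanging the sums, Bessel is used a second time, now in mode `p` and for the
  -- orthonormal columns of W.
  exact mul_le_of_le_one_right (sq_nonneg _) ((hW.2 p hp).sum_sq_inner_le_one (hU.1 p k))

/-- In each of the R squares the cross term is at most (1 + Q)‖E‖, because 2|a| ≤ 1 + a² and a² ≤ Q,
and the quadratic noise term is at most ‖E‖ because ‖E‖ ≤ 1. -/
theorem objective_add_le {Q : ℝ} (B E : Tensor n) (hE : ‖E‖ ≤ 1) {W : Factors n R}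
    (hW : ∀ l i, ‖W l i‖ = 1) (hB : objective B W ≤ Q) :
    objective (B + E) W ≤ Q + (R * (2 + Q)) * ‖E‖ := by
  have h1 : ∀ i, ⟪B + E, outer fun l => W l i⟫_ℝ ^ 2 ≤
      ⟪B, outer fun l => W l i⟫_ℝ ^ 2 + (2 + Q) * ‖E‖ := fun i => by
    have h2 : |⟪E, outer fun l => W l i⟫_ℝ| ≤ ‖E‖ := by
      simpa [norm_outer_of_norm_one fun l => hW l i] using
        abs_real_inner_le_norm E (outer fun l => W l i)
    have h3 : ⟪B, outer fun l => W l i⟫_ℝ ^ 2 ≤ Q :=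
      (Finset.single_le_sum (f := fun i => ⟪B, outer fun l => W l i⟫_ℝ ^ 2)
        (fun i _ => sq_nonneg _) (Finset.mem_univ i)).trans hB
    rw [inner_add_left]
    generalize ⟪B, outer fun l => W l i⟫_ℝ = a at *
    generalize ⟪E, outer fun l => W l i⟫_ℝ = e at *
    have h4 : 2 * |a| ≤ 1 + Q := by nlinarith [sq_nonneg (|a| - 1), sq_abs a]
    have h5 : e ^ 2 ≤ ‖E‖ := by
      rw [← sq_abs]
      nlinarith [abs_nonneg e, norm_nonneg E]
    have h6 : 2 * (a * e) ≤ (1 + Q) * ‖E‖ := by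
      calc 2 * (a * e) ≤ 2 * |a| * |e| := by
            rw [mul_assoc, ← abs_mul]
            exact mul_le_mul_of_nonneg_left (le_abs_self _) zero_le_two
        _ ≤ (1 + Q) * ‖E‖ := mul_le_mul h4 h2 (abs_nonneg _) (by linarith [abs_nonneg a])
    linarith [add_sq a e]
  refine (Finset.sum_le_sum fun i _ => h1 i).trans ?_
  rw [Finset.sum_add_distrib, Finset.sum_const, Finset.card_univ, Fintype.card_fin, nsmul_eq_mul,
    mul_assoc]
  exact add_le_add_left hB _

theorem continuous_objective (A : Tensor n) : Continuous fun U : Factors n R => objective A U := by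
  simp only [objective, EuclideanSpace.real_inner_eq_sum, outer]
  fun_prop

theorem isGreatest_gmax {O : ι → Prop} {U : Factors n R} (hU : Feasible O U) (A : Tensor n) :
    IsGreatest (objectiveValues R O A) (Gmax R O A) := by
  have : objectiveValues R O A = (fun U => objective A U) '' {U | Feasible O U} := rfl
  have hc : IsCompact (objectiveValues R O A) :=
    this ▸ (isCompact_setOf_feasible O).image (continuous_objective A)
  exact hc.isGreatest_sSup ⟨_, U, hU, rfl⟩

end Objective

/-! ### Feasibility of the output -/

section Feasible

variable {ι : Type} [Fintype ι] [LinearOrder ι] {n : ι → ℕ} {R : ℕ}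

theorem IsRank1Approx.norm_eq_one {rk : Rank1Proc} {k : (l : ι) → Fin (n l)} {T : Tensor n}
    {x : (l : ι) → EuclideanSpace ℝ (Fin (n l))} (h : IsRank1Approx rk k T x) (j : ι) :
    ‖x j‖ = 1 := by
  cases rk with
  | self proc => exact (OrthonormalPhase.orthonormal h (j := j) trivial).1 0
  | quasiOptimal κ => exact h.1 j

theorem IsAlgorithmOutput.feasible {proc : GetVProc} {rk : Rank1Proc} {O : ι → Prop}
    [DecidablePred O] {k : (l : ι) → Fin R → Fin (n l)} {A : Tensor n} {U : Factors n R}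
    (h : IsAlgorithmOutput proc rk O k A U) : Feasible O U := by
  refine ⟨fun j i => ?_, fun j hj => h.orthonormal.orthonormal hj⟩
  by_cases hj : O j
  · exact (h.orthonormal.orthonormal hj).1 i
  · exact (h.rank1 i).norm_eq_one ⟨j, hj⟩

end Feasible

/-! ### Stability of the whole algorithm -/

section Main

variable {X : Type*} {l : Filter X} {g : X → ℝ}
variable {ι : Type} [Fintype ι] [LinearOrder ι] {n : ι → ℕ} {R : ℕ}

/-- When the algorithm calls itself, R = 1 makes orthonormality and distinctness of singular values
trivial, so the orthonormal phase analysis applies to all modes. -/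
theorem near_of_isRank1Approx (hg : g =O[l] fun _ => (1 : ℝ)) {c : X → ℝ} {τ : ℝ} (hτ : 0 < τ)
    (hc : ∀ x, |c x| = τ) {u : (l : ι) → EuclideanSpace ℝ (Fin (n l))} (hu : ∀ l, ‖u l‖ = 1)
    {T : X → Tensor n} (hT : Near l g T fun x => c x • outer u) {rk : Rank1Proc}
    {k : X → (l : ι) → Fin (n l)}
    (hk : rk = Rank1Proc.self GetVProc.C → ∀ x j, u j (k x j) ≠ 0)
    {v : X → (l : ι) → EuclideanSpace ℝ (Fin (n l))}
    (hv : ∀ x, IsRank1Approx rk (k x) (T x) (v x)) (j : ι) :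
    ∃ s : X → ℝ, (∀ x, IsSign (s x)) ∧ Near l g (fun x => v x j) (fun x => s x • u j) := by
  cases rk with
  | self proc =>
    have hT' : Near l g T fun x => ∑ _i : Fin 1, c x • outer fun l => u l := by simpa using hT
    obtain ⟨s, hs, h⟩ := near_of_orthonormalPhase hg (σ := fun x (_ : Fin 1) => c x)
      (τ := fun _ => τ) (fun x _ => hc x) (Subsingleton.strictAnti _) (fun _ => hτ)
      (O := fun _ => True) (fun _ _ _ _ => trivial) (U := fun l _ => u l) (fun l _ => hu l)
      (fun l _ => orthonormal_fin_one (hu l))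
      (fun j _ => orthonormal_fin_one (norm_outer_of_norm_one fun l : {l : ι // l < j} => hu l))
      (A := T) hT' (k := fun x l _ => k x l)
      (fun h x j _ _ => hk (by rw [h]) x j) hv j trivial
    exact ⟨fun x => s x 0, fun x => hs x 0, h 0⟩
  | quasiOptimal κ =>
    choose s hs h using fun x =>
      exists_isSign_norm_sub_le_of_isQuasiOptimalRank1 hτ (hc x) hu (hv x) j
    exact ⟨s, hs, hT.norm_le ⟨_, h⟩⟩

theorem near_of_isAlgorithmOutput (hg : g =O[l] fun _ => (1 : ℝ)) {σ : Fin R → ℝ}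
    (hσ : StrictAnti σ) (hσ0 : ∀ i, 0 < σ i) {O : ι → Prop} [DecidablePred O]
    (hO : ∀ j m, O j → j < m → O m) {p q : ι} (hpq : p < q) (hp : O p)
    {U : Factors n R} (hU : Feasible O U)
    {A : X → Tensor n} (hA : Near l g A fun _ => ∑ i, σ i • outer fun l => U l i)
    {proc : GetVProc} {rk : Rank1Proc} {k : X → (l : ι) → Fin R → Fin (n l)}
    (hk : ∀ x, GoodDraws proc rk O U (k x)) {U₀ : X → Factors n R}
    (hU₀ : ∀ x, IsAlgorithmOutput proc rk O (k x) (A x) (U₀ x)) (j : ι) (i : Fin R) :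
    ∃ s : X → ℝ, (∀ x, IsSign (s x)) ∧
      Near l g (fun x => U₀ x j i) (fun x => s x • U j i) := by
  have hσ1 : ∀ (_ : X) i, |σ i| = σ i := fun _ i => abs_of_pos (hσ0 i)
  have h1 : ∀ j, O j → ∃ s : X → Fin R → ℝ, (∀ x i, IsSign (s x i)) ∧
      ∀ i, Near l g (fun x => U₀ x j i) (fun x => s x i • U j i) := by
    refine near_of_orthonormalPhase hg hσ1 hσ hσ0 hO hU.1 hU.2 (fun m hm => ?_) hA
      (fun h x j i hj => (hk x).1 h j i hj) fun x => (hU₀ x).orthonormal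
    -- The rank-1 tensors over the modes below the last one are orthogonal because the orthonormal
    -- mode `p` is among those modes.
    refine ⟨fun i => norm_outer_of_norm_one fun l : {l : ι // l < m} => hU.1 l i,
      fun i k hik => ?_⟩
    exact (inner_outer (fun l : {l : ι // l < m} => U l i) fun l => U l k).trans
      (Finset.prod_eq_zero (Finset.mem_univ ⟨p, hpq.trans_le (hm q)⟩) ((hU.2 p hp).2 hik))
  by_cases hj : O j
  · obtain ⟨s, hs, h⟩ := h1 j hj
    exact ⟨fun x => s x i, fun x => hs x i, h i⟩
  · have h2 : ∀ j, ∃ s : X → Fin R → ℝ, O j → (∀ x i, IsSign (s x i)) ∧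
        ∀ i, Near l g (fun x => U₀ x j i) (fun x => s x i • U j i) := fun j => by
      by_cases hj : O j
      · obtain ⟨s, hs⟩ := h1 j hj
        exact ⟨s, fun _ => hs⟩
      · exact ⟨fun _ _ => 0, fun h => absurd h hj⟩
    choose s hs using h2
    have hT := near_contract hg hσ1 hU.1 ⟨p, hp, hU.2 p hp⟩ hA (i := i)
      (s := fun x j => s j x i) (fun x j hj => (hs j hj).1 x i) (u := fun x l => U₀ x l i)
      (fun x l _ => (hU₀ x).feasible.1 l i) (fun j hj => (hs j hj).2 i)
    refine near_of_isRank1Approx hg (hσ0 i) (fun x => ?_)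
      (fun l : {l : ι // ¬ O l} => hU.1 l i) hT (k := fun x l => k x l i)
      (fun h x j => (hk x).2 h j i j.2) (v := fun x l => U₀ x l i)
      (fun x => (hU₀ x).rank1 i) ⟨j, hj⟩
    have : IsSign (∏ j with O j, s j x i) :=
      IsSign.prod fun j hj => (hs j (by simpa using hj)).1 x i
    rw [abs_mul, this.abs, mul_one, hσ1 x]

/-- Each inner product is close to ±σ_i, since the orthonormal mode `p` removes the cross terms;
squaring removes the sign. -/
theorem near_objective (hg : g =O[l] fun _ => (1 : ℝ)) {σ : Fin R → ℝ}
    (hσ0 : ∀ i, 0 < σ i) {O : ι → Prop} {p : ι} (hp : O p) {U : Factors n R}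
    (hU : Feasible O U)
    {A : X → Tensor n} (hA : Near l g A fun _ => ∑ i, σ i • outer fun l => U l i)
    {U₀ : X → Factors n R} (hU₀ : ∀ x l i, ‖U₀ x l i‖ = 1)
    (h : ∀ j i, ∃ s : X → ℝ, (∀ x, IsSign (s x)) ∧
      Near l g (fun x => U₀ x j i) (fun x => s x • U j i)) :
    Near l g (fun x => objective (A x) (U₀ x)) (fun _ => ∑ i, σ i ^ 2) := by
  choose s hs hs' using h
  refine Near.sum fun i _ => ?_
  have e1 := near_inner_outer hA (v := fun x l => U₀ x l i) fun x l => hU₀ x l i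
  simp only [inner_sum_smul_outer] at e1
  have e2 := near_sum_mul_prod_inner hg (σ := fun _ => σ) (τ := σ)
    (fun _ i => abs_of_pos (hσ0 i)) (t := Finset.univ) (i := i) ⟨p, Finset.mem_univ p, hU.2 p hp⟩
    hU.1 (s := fun x j => s j i x) (fun x j _ => hs j i x) (v := fun x l => U₀ x l i)
    (fun j _ => hs' j i) (fun _ => 1)
  simp only [one_mul] at e2
  have hb : (fun x => σ i * ∏ j, s j i x) =O[l] fun _ => (1 : ℝ) :=
    bounded_one_of_le (σ i) fun x => by
      rw [Real.norm_eq_abs, abs_mul, (IsSign.prod fun j _ => hs j i x).abs, mul_one,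
        abs_of_pos (hσ0 i)]
  have e3 := Near.mul hg (e1.trans e2) (e1.trans e2) hb hb
  convert e3 using 2 with x x
  · rw [sq]
  · have := (IsSign.prod (t := Finset.univ) fun j _ => hs j i x).mul_self
    linear_combination (-σ i ^ 2) * this

end Main

/-! ### Uniform constants and conclusion -/

theorem IsSign.min_norm_add_norm_sub_le {E : Type*} [SeminormedAddCommGroup E] [NormedSpace ℝ E]
    {s : ℝ} (hs : IsSign s) (y u : E) : min ‖y + u‖ ‖y - u‖ ≤ ‖y - s • u‖ := by
  rcases hs with rfl | rfl
  · simp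
  · simp

/-- Along ⊤, "eventually" means everywhere, so the implied constant is uniform over `X`. -/
theorem Near.exists_bound {X E : Type*} [SeminormedAddCommGroup E] {g : X → ℝ} {f f' : X → E}
    (h : Near ⊤ g f f') : ∃ C, 0 ≤ C ∧ ∀ x, ‖f x - f' x‖ ≤ C * ‖g x‖ := by
  obtain ⟨C, hC, h⟩ := IsBigO.exists_nonneg h
  exact ⟨C, hC, by simpa [isBigOWith_iff] using h⟩

theorem mainTheorem4 (d R t : ℕ) (hd : 3 ≤ d) (hR : 1 ≤ R) (ht : 2 ≤ t) (htd : t ≤ d)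
    (n : Fin d → ℕ) (σ : Fin R → ℝ) (hσ : StrictAnti σ) (hσ_pos : ∀ i, 0 < σ i)
    (U : Factors n R) (hU : Feasible (lastModes d t) U)
    (proc : GetVProc) (rk : Rank1Proc) :
    ∃ C : ℝ, 0 ≤ C ∧ ∃ ε : ℝ, 0 < ε ∧ ∀ E A : Tensor n, ‖E‖ ≤ ε →
      A = ∑ i, σ i • outer (fun l => U l i) + E →
      IsGreatest (objectiveValues R (lastModes d t) A) (Gmax R (lastModes d t) A) ∧
      ∀ (k : (l : Fin d) → Fin R → Fin (n l)) (U₀ : Factors n R),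
        GoodDraws proc rk (lastModes d t) U k →
        IsAlgorithmOutput proc rk (lastModes d t) k A U₀ →
          0 ≤ Gmax R (lastModes d t) A - objective A U₀ ∧
          Gmax R (lastModes d t) A - objective A U₀ ≤ C * ‖E‖ ∧
          ∀ j i, min ‖U₀ j i + U j i‖ ‖U₀ j i - U j i‖ ≤ C * ‖E‖ := by
  set B : Tensor n := ∑ i, σ i • outer (fun l => U l i) with hB
  set Q : ℝ := ∑ i, σ i ^ 2 with hQ
  -- The last two modes in zero-based indexing; both are orthonormal because t ≥ 2.
  let p : Fin d := ⟨d - 2, by omega⟩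
  let q : Fin d := ⟨d - 1, by omega⟩
  have hpq : p < q := Fin.mk_lt_mk.2 (by omega)
  have hp : lastModes d t p := by simp only [lastModes, p]; omega
  have hq : lastModes d t q := by simp only [lastModes, q]; omega
  -- All triples of noise, draws and output form a single index type, so a bound along ⊤ has a
  -- constant independent of each of them.
  let X := {y : Tensor n × ((l : Fin d) → Fin R → Fin (n l)) × Factors n R //
    ‖y.1‖ ≤ 1 ∧ GoodDraws proc rk (lastModes d t) U y.2.1 ∧
      IsAlgorithmOutput proc rk (lastModes d t) y.2.1 (B + y.1) y.2.2}
  let g : X → ℝ := fun y => ‖y.1.1‖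
  have hg : g =O[⊤] fun _ => (1 : ℝ) := bounded_one_of_le 1 fun y => by
    simpa [g] using y.2.1
  have hA : Near ⊤ g (fun y : X => B + y.1.1) (fun _ => B) :=
    IsBigO.of_bound 1 (Eventually.of_forall fun y => by simp [g])
  have hnear := near_of_isAlgorithmOutput hg hσ hσ_pos
    (fun j m (hj : lastModes d t j) hjm => le_trans hj (Fin.le_def.1 hjm.le)) hpq hp hU hA
    (k := fun y : X => y.1.2.1) (fun y => y.2.2.1) (U₀ := fun y : X => y.1.2.2)
    (fun y => y.2.2.2)
  obtain ⟨C₁, hC₁, hobj⟩ := (near_objective hg hσ_pos hp hU hA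
    (fun y l i => y.2.2.2.feasible.1 l i) hnear).exists_bound
  choose s hs hs' using hnear
  choose C₂ hC₂ hfac using fun j i => (hs' j i).exists_bound
  have hQ0 : 0 ≤ Q := Finset.sum_nonneg fun i _ => sq_nonneg _
  have hsum : 0 ≤ ∑ j, ∑ i, C₂ j i :=
    Finset.sum_nonneg fun j _ => Finset.sum_nonneg fun i _ => hC₂ j i
  have hK : 0 ≤ R * (2 + Q) := by positivity
  -- The three summands control the rise of G_max above Q, the drop of the computed objective below
  -- Q, and the factor errors. The radius 1 suffices because no stability estimate requires small
  -- noise.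
  refine ⟨R * (2 + Q) + C₁ + ∑ j, ∑ i, C₂ j i, by positivity, 1, one_pos, ?_⟩
  rintro E _ hE rfl
  have hmax := isGreatest_gmax hU (B + E)
  refine ⟨hmax, fun k U₀ hk hU₀ => ⟨?_, ?_, fun j i => ?_⟩⟩
  · exact sub_nonneg.2 (hmax.2 ⟨U₀, hU₀.feasible, rfl⟩)
  · obtain ⟨W, hW, hWmax⟩ := hmax.1
    have h1 := objective_add_le B E hE hW.1
      (objective_sum_smul_outer_le σ hpq.ne hp hq hU hW)
    have h2 := (abs_le.1 (hobj ⟨(E, k, U₀), hE, hk, hU₀⟩)).1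
    simp only [g, norm_norm] at h2
    rw [← hWmax]
    have h3 := mul_nonneg hsum (norm_nonneg E)
    linarith
  · have h1 := hfac j i ⟨(E, k, U₀), hE, hk, hU₀⟩
    simp only [g, norm_norm] at h1
    refine ((hs j i _).min_norm_add_norm_sub_le _ _).trans (h1.trans ?_)
    refine mul_le_mul_of_nonneg_right ?_ (norm_nonneg E)
    have h2 : C₂ j i ≤ ∑ j, ∑ i, C₂ j i :=
      (Finset.single_le_sum (fun i _ => hC₂ j i) (Finset.mem_univ i)).trans
        (Finset.single_le_sum (f := fun j => ∑ i, C₂ j i)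
          (fun j _ => Finset.sum_nonneg fun i _ => hC₂ j i) (Finset.mem_univ j))
    linarith
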